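/- **Stability of persistence diagrams.** *Categorical persistence functions.* A categorical persistence function on a category $\mathbf R$ is a function $p$ from the morphisms of $\mathbf R$ to $\mathbb Z$ that is bounded below and satisfies, for all composable $u_1\to u_2\to v_1\to v_2$ in $\mathbf R$, $p(u_1\to v_1)\le p(u_2\to v_1)$, $p(u_2\to v_2)\le p(u_2\to v_1)$ and $p(u_2\to v_1)-p(u_1\to v_1)\ge p(u_2\to v_2)-p(u_1\to v_2)$. *Tame diagrams.* For an $(\mathbb R,\le)$-indexed diagram $F$ in $\mathbf R$ (a functor $F:(\mathbb R,\le)\to\mathbf R$) put $p_F(u,v)=p(F(u\le v))$ for $u\le v$. A real number $a$ is a regular value of $F$ if it has a connected neighbourhood $I$ with $p_F(x,x)=p_F(x,y)=p_F(y,y)$ for all $x\le y$ in $I$, and a critical value otherwise; $F$ is tame if it has only finitely many critical values. *Persistence diagrams.* Put $p_F(u,v)=\min_{x\le y}p_F(x,y)$ when $u\le v$ in $[-\infty,\infty]$ are not both finite. For $u<v$ in $[-\infty,\infty]$ the multiplicity $\mu_F(u,v)$ is the minimum of $$p_F(\sup I,\inf J)-p_F(\inf I,\inf J)-p_F(\sup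 I,\sup J)+p_F(\inf I,\sup J)$$ over all disjoint connected neighbourhoods $I$ of $u$ and $J$ of $v$ in $[-\infty,\infty]$; $(u,v)$ is a cornerpoint if $\mu_F(u,v)>0$. The persistence diagram $\mathcal DF$ is the multiset consisting of the cornerpoints $(u,v)$, with multiplicity $\mu_F(u,v)$, and all the diagonal points $(u,u)$, $u\in\mathbb R$, each with countably infinite multiplicity. *Distances.* The bottleneck distance is $$d(\mathcal DF,\mathcal DG)=\inf_{\beta}\ \sup_{x\in\mathcal DF}\|x-\beta(x)\|_\infty\in[0,\infty],$$ where $\beta$ ranges over all bijections of multisets $\mathcal DF\to\mathcal DG$; here two equal infinite coordinates are at distance $0$, and an infinite coordinate is at distance $\infty$ from every other one. For $\epsilon\ge 0$, $F$ and $G$ are $\epsilon$-interleaved if there are natural families of morphisms $\varphi_x:F(x)\to G(x+\epsilon)$ and $\psi_x:G(x)\to F(x+\epsilon)$, $x\in\mathbb R$, with $\psi_{x+\epsilon}\varphi_x=F(x\le x+2\epsilon)$ and $\varphi_{x+\epsilon}\psi_x=G(x\le x+2\epsilon)$ for all $x$. The interleaving distance $d_{\mathbf R}(F,G)\in[0,\infty]$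 is the infimum of all $\epsilon\ge0$ such that $F$ and $G$ are $\epsilon$-interleaved ($\infty$ if there are none). **Theorem.** Let $\mathbf R$ be a category with finite colimits and let $p$ be a categorical persistence function on $\mathbf R$. If $F_1,F_2$ are two tame $(\mathbb R,\le)$-indexed diagrams in $\mathbf R$, then $$d_{\mathbf R}(F_1,F_2)\ \ge\ d(\mathcal DF_1,\mathcal DF_2).$$ -/

import Mathlib

open CategoryTheory Topology
open scoped ENNReal NNReal

universe v u

noncomputable section

/-- A categorical persistence function on a category `C`: a lower-bounded integer-valued function
on the morphisms of `C` such that, for all `u₁ ⟶ u₂ ⟶ v₁ ⟶ v₂`,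
`p (u₁ ⟶ v₁) ≤ p (u₂ ⟶ v₁)`, `p (u₂ ⟶ v₂) ≤ p (u₂ ⟶ v₁)` and
`p (u₂ ⟶ v₁) - p (u₁ ⟶ v₁) ≥ p (u₂ ⟶ v₂) - p (u₁ ⟶ v₂)`. -/
structure CatPersistenceFunction (C : Type u) [Category.{v} C] where
  toFun : ∀ {X Y : C}, (X ⟶ Y) → ℤ
  lower_bounded : ∃ m : ℤ, ∀ {X Y : C} (f : X ⟶ Y), m ≤ toFun f
  precomp_le : ∀ {u₁ u₂ v₁ : C} (f : u₁ ⟶ u₂) (g : u₂ ⟶ v₁), toFun (f ≫ g) ≤ toFun g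
  postcomp_le : ∀ {u₂ v₁ v₂ : C} (g : u₂ ⟶ v₁) (h : v₁ ⟶ v₂), toFun (g ≫ h) ≤ toFun g
  jump_le : ∀ {u₁ u₂ v₁ v₂ : C} (f : u₁ ⟶ u₂) (g : u₂ ⟶ v₁) (h : v₁ ⟶ v₂),
    toFun g - toFun (f ≫ g) ≥ toFun (g ≫ h) - toFun (f ≫ g ≫ h)

namespace Persistence

variable {C : Type u} [Category.{v} C]

/-- The persistence function `p_F (a, b) = p (F (a ≤ b))` induced by an `(ℝ, ≤)`-indexed diagram. -/
def pF (p : CatPersistenceFunction C) (F : ℝ ⥤ C) {a b : ℝ} (h : a ≤ b) : ℤ :=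
  p.toFun (F.map (homOfLE h))

/-- `F` is constant on `I`: `p_F (a, a) = p_F (a, b) = p_F (b, b)` for all `a ≤ b` in `I`. -/
def IsConstantOn (p : CatPersistenceFunction C) (F : ℝ ⥤ C) (I : Set ℝ) : Prop :=
  ∀ ⦃a b : ℝ⦄ (h : a ≤ b), a ∈ I → b ∈ I →
    pF p F (le_refl a) = pF p F h ∧ pF p F h = pF p F (le_refl b)

/-- `a` is a regular value if `F` is constant on some connected neighbourhood of `a`. -/
def IsRegularValue (p : CatPersistenceFunction C) (F : ℝ ⥤ C) (a : ℝ) : Prop :=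
  ∃ I : Set ℝ, I ∈ 𝓝 a ∧ _root_.IsConnected I ∧ IsConstantOn p F I

/-- `F` is tame if it has finitely many critical (that is, non-regular) values. -/
def IsTame (p : CatPersistenceFunction C) (F : ℝ ⥤ C) : Prop :=
  {a : ℝ | ¬ IsRegularValue p F a}.Finite

/-- The minimum of `p_F (x, y)` over all `x ≤ y` (attained, since `p` is lower bounded). -/
def pMin (p : CatPersistenceFunction C) (F : ℝ ⥤ C) : ℤ :=
  sInf {n : ℤ | ∃ (x y : ℝ) (h : x ≤ y), n = pF p F h}

/-- `p_F` on pairs `u ≤ v` of extended reals: `p_F (u, v)` if `u` and `v` are both finite, and the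
minimum of `p_F` if one of them is infinite. (It is only ever used at pairs with `u ≤ v`; for such
pairs, both are finite if and only if `u ≠ ⊥` and `v ≠ ⊤`.) -/
def pExt (p : CatPersistenceFunction C) (F : ℝ ⥤ C) (u v : EReal) : ℤ :=
  open Classical in
  if h : u ≤ v ∧ u ≠ ⊥ ∧ v ≠ ⊤ then pF p F (EReal.toReal_le_toReal h.1 h.2.1 h.2.2)
  else pMin p F

/-- The alternating sum whose minimum over small neighbourhoods `I` of `u` and `J` of `v` is the
multiplicity of `(u, v)`. -/
def boxSum (p : CatPersistenceFunction C) (F : ℝ ⥤ C) (I J : Set EReal) : ℤ :=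
  pExt p F (sSup I) (sInf J) - pExt p F (sInf I) (sInf J)
    - pExt p F (sSup I) (sSup J) + pExt p F (sInf I) (sSup J)

/-- The multiplicity `μ (u, v)` for `u < v` in `[-∞, ∞]`: the minimum of `boxSum` over disjoint
connected neighbourhoods of `u` and `v` in `[-∞, ∞]`. -/
def cornerMultiplicity (p : CatPersistenceFunction C) (F : ℝ ⥤ C) (u v : EReal) : ℤ :=
  sInf {n : ℤ | ∃ I J : Set EReal, I ∈ 𝓝 u ∧ J ∈ 𝓝 v ∧
    _root_.IsConnected I ∧ _root_.IsConnected J ∧ Disjoint I J ∧ n = boxSum p F I J}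

/-- A multiset of points of `[-∞, ∞]²` with multiplicities in `ℕ ∪ {∞}`, where `∞` means countably
infinite. -/
abbrev Diagram : Type := EReal × EReal → ℕ∞

/-- The persistence diagram of `F`: the cornerpoints `(u, v)`, `u < v`, with their multiplicities
(a multiplicity is positive exactly at a cornerpoint), together with all diagonal points `(u, u)`,
`u` real, with countably infinite multiplicity. -/
def diagram (p : CatPersistenceFunction C) (F : ℝ ⥤ C) : Diagram := fun q =>
  open Classical in
  if q.1 < q.2 then ((cornerMultiplicity p F q.1 q.2).toNat : ℕ∞)
  else if ∃ r : ℝ, q = ((r : EReal), (r : EReal)) then ⊤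
  else 0

/-- The elements of a diagram, listed with multiplicity: a point `x` of multiplicity `m` gives the
elements `(x, n)`, `n = 0, 1, …`, `n < m`. -/
def Diagram.Elem (D : Diagram) : Type :=
  {q : (EReal × EReal) × ℕ // (q.2 : ℕ∞) < D q.1}

/-- `|x - y|` on `[-∞, ∞]`, with `|∞ - ∞| = |(-∞) - (-∞)| = 0` and `∞` for all other pairs in which
one of the two is infinite. -/
def extDist (x y : EReal) : ℝ≥0∞ :=
  open Classical in
  if x = y then 0 else (x - y).abs

/-- The distance `‖x - y‖_∞` on `[-∞, ∞]²`. -/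
def supDist (x y : EReal × EReal) : ℝ≥0∞ :=
  max (extDist x.1 y.1) (extDist x.2 y.2)

/-- The bottleneck distance: the infimum, over all bijections `β` between two diagrams, of
`sup_x ‖x - β x‖_∞`. -/
def bottleneckDist (D E : Diagram) : ℝ≥0∞ :=
  ⨅ β : D.Elem ≃ E.Elem, ⨆ x : D.Elem, supDist x.1.1 (β x).1.1

/-- The translation functor `T_ε : (ℝ, ≤) ⥤ (ℝ, ≤)`, `x ↦ x + ε`. -/
def translation (ε : ℝ) : ℝ ⥤ ℝ :=
  Monotone.functor (f := fun x : ℝ => x + ε) fun _ _ h => by simpa using h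

lemma le_add_add (ε : ℝ≥0) (x : ℝ) : x ≤ x + ε + ε := by
  have := ε.2
  linarith

/-- `F` and `G` are `ε`-interleaved: there are natural transformations `φ : F ⟶ G T_ε` and
`ψ : G ⟶ F T_ε` such that `(ψ T_ε) φ` and `(φ T_ε) ψ` are given by the structure maps
`F (x ≤ x + 2ε)` and `G (x ≤ x + 2ε)`. -/
def Interleaved (ε : ℝ≥0) (F G : ℝ ⥤ C) : Prop :=
  ∃ (φ : F ⟶ translation ε ⋙ G) (ψ : G ⟶ translation ε ⋙ F),
    (∀ x : ℝ, φ.app x ≫ ψ.app (x + ε) = F.map (homOfLE (le_add_add ε x))) ∧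
    (∀ x : ℝ, ψ.app x ≫ φ.app (x + ε) = G.map (homOfLE (le_add_add ε x)))

/-- The interleaving distance: the infimum of all `ε ≥ 0` such that `F` and `G` are
`ε`-interleaved, equal to `∞` if there is no such `ε`. -/
def interleavingDist (F G : ℝ ⥤ C) : ℝ≥0∞ :=
  ⨅ (ε : ℝ≥0) (_ : Interleaved ε F G), (ε : ℝ≥0∞)

end Persistence

end

namespace Persistence

/-! ### Box functions of two-variable functions on `[-∞, ∞]` -/

/-! It suffices to match the two diagrams within `ε` whenever an `ε`-interleaving exists. An
interleaving yields a box inequality (`Interleaved.box_le`): the alternating sum of `p_F` over a box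
is at most that of `p_G` over the box enlarged by `ε`. This alone does not give Hall's condition,
since the `ε`-squares around several cornerpoints may overlap.

The remedy is to move in small steps. Finite colimits give a path of diagrams `H_s`, `0 ≤ s ≤ ε`,
from `F` to `G`: `H_s(x)` glues `F(x - s)` to `G(x - ε + s)` along `F(x - 2ε + s)` and `G(x - ε -
s)`, the last positions on each line lying below both. Any `H_s` and `H_t` are `|s - t|`-interleaved
(`interleaved_interp`), so `H_s` gives a family satisfying box inequalities, a `BoxFlow`.

For a finite set `A` of points whose closed `ε`-squares avoid the diagonal, the mass in the closed
`s`-neighbourhood of `A` at time `s` never falls below its initial value (`BoxFlow.hasMass`). This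
is an induction along the interval: for a short step forward the squares around finitely many points
are disjoint, and limits from the left are handled by compactness. At `s = ε` it is Hall's condition
for the cornerpoints far from the diagonal. The other points go to the diagonal, which gives an
injection moving points by at most `ε`. The same holds with `F` and `G` exchanged, and a
Schröder–Bernstein argument that respects the relation of being within `ε` turns the two injections
into a bijection. -/

/-- The alternating sum of `e` over the corners of the box `[a, b] × [c, d]`. -/
def box (e : EReal → EReal → ℤ) (a b c d : EReal) : ℤ :=
  e b c - e a c - e b d + e a d

/-- All boxes above the diagonal have nonnegative alternating sum. -/
def BoxNonneg (e : EReal → EReal → ℤ) : Prop :=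
  ∀ ⦃a b c d : EReal⦄, a ≤ b → b ≤ c → c ≤ d → 0 ≤ box e a b c d

/-- `Ici l` is a neighbourhood of `a`. -/
def LowerNhd (l a : EReal) : Prop := l < a ∨ l = ⊥

/-- `Iic r` is a neighbourhood of `a`. -/
def UpperNhd (a r : EReal) : Prop := a < r ∨ r = ⊤

lemma LowerNhd.le {l a : EReal} (h : LowerNhd l a) : l ≤ a := by
  rcases h with h | rfl
  exacts [h.le, bot_le]

lemma UpperNhd.le {a r : EReal} (h : UpperNhd a r) : a ≤ r := by
  rcases h with h | rfl
  exacts [h.le, le_top]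

lemma LowerNhd.sup {l l' a : EReal} (h : LowerNhd l a) (h' : LowerNhd l' a) :
    LowerNhd (l ⊔ l') a := by
  rcases h with h | rfl
  · rcases h' with h' | rfl
    · exact Or.inl (sup_lt_iff.2 ⟨h, h'⟩)
    · exact Or.inl (by simpa using h)
  · simpa using h'

lemma UpperNhd.inf {a r r' : EReal} (h : UpperNhd a r) (h' : UpperNhd a r') :
    UpperNhd a (r ⊓ r') := by
  rcases h with h | rfl
  · rcases h' with h' | rfl
    · exact Or.inl (lt_inf_iff.2 ⟨h, h'⟩)
    · exact Or.inl (by simpa using h)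
  · simpa using h'

lemma LowerNhd.finset_sup {ι : Type*} {T : Finset ι} {f : ι → EReal} {a : EReal}
    (h : ∀ i ∈ T, LowerNhd (f i) a) : LowerNhd (T.sup f) a :=
  Finset.sup_induction (p := fun l => LowerNhd l a) (Or.inr rfl) (fun _ h _ h' => h.sup h') h

lemma UpperNhd.finset_inf {ι : Type*} {T : Finset ι} {f : ι → EReal} {a : EReal}
    (h : ∀ i ∈ T, UpperNhd a (f i)) : UpperNhd a (T.inf f) :=
  Finset.inf_induction (p := fun l => UpperNhd a l) (Or.inr rfl) (fun _ h _ h' => h.inf h') h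

lemma LowerNhd.Ici_mem {l a : EReal} (h : LowerNhd l a) : Set.Ici l ∈ 𝓝 a := by
  rcases h with h | rfl
  · exact Ici_mem_nhds h
  · simp

lemma UpperNhd.Iic_mem {a r : EReal} (h : UpperNhd a r) : Set.Iic r ∈ 𝓝 a := by
  rcases h with h | rfl
  · exact Iic_mem_nhds h
  · simp

lemma Icc_mem_nhds_of {l a r : EReal} (h : LowerNhd l a) (h' : UpperNhd a r) :
    Set.Icc l r ∈ 𝓝 a :=
  Filter.inter_mem h.Ici_mem h'.Iic_mem

lemma lowerNhd_of_mem {l a : EReal} (h : Set.Ici l ∈ 𝓝 a) : LowerNhd l a := by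
  by_contra hcon
  simp only [LowerNhd, not_or, not_lt] at hcon
  obtain rfl : a = l := le_antisymm hcon.1 (mem_of_mem_nhds h)
  obtain ⟨b, hb, hb'⟩ := exists_Ioc_subset_of_mem_nhds h ⟨⊥, bot_lt_iff_ne_bot.2 hcon.2⟩
  obtain ⟨c, hbc, hca⟩ := exists_between hb
  exact absurd (hb' ⟨hbc, hca.le⟩) (not_le.2 hca)

lemma upperNhd_of_mem {a r : EReal} (h : Set.Iic r ∈ 𝓝 a) : UpperNhd a r := by
  by_contra hcon
  simp only [UpperNhd, not_or, not_lt] at hcon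
  obtain rfl : a = r := le_antisymm (Set.mem_Iic.1 (mem_of_mem_nhds h)) hcon.1
  obtain ⟨b, hb, hb'⟩ := exists_Ico_subset_of_mem_nhds h ⟨⊤, lt_top_iff_ne_top.2 hcon.2⟩
  obtain ⟨c, hbc, hca⟩ := exists_between hb
  exact absurd (hb' ⟨hbc.le, hca⟩) (not_le.2 hbc)

/-- The multiplicity of a point `(u, v)`: the least alternating sum over boxes around it. -/
noncomputable def pointMult (e : EReal → EReal → ℤ) (u v : EReal) : ℤ :=
  sInf {n : ℤ | ∃ a b c d : EReal, LowerNhd a u ∧ UpperNhd u b ∧ LowerNhd c v ∧ UpperNhd v d ∧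
    b ≤ c ∧ n = box e a b c d}

section

variable {e : EReal → EReal → ℤ}

/-- The outer box is tiled by the inner one and four others, all of nonnegative sum: the two
full-height strips at the sides and the pieces below and above the inner box. -/
lemma BoxNonneg.box_mono (he : BoxNonneg e) {a a' b' b c c' d' d : EReal} (ha : a ≤ a')
    (hab : a' ≤ b') (hb : b' ≤ b) (hbc : b ≤ c) (hc : c ≤ c') (hcd : c' ≤ d') (hd : d' ≤ d) :
    box e a' b' c' d' ≤ box e a b c d := by
  have h1 := he ha ((hab.trans hb).trans hbc) ((hc.trans hcd).trans hd)
  have h2 := he hb hbc ((hc.trans hcd).trans hd)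
  have h3 := he hab (hb.trans hbc) hc
  have h4 := he hab (hb.trans (hbc.trans (hc.trans hcd))) hd
  unfold box at *
  linarith

lemma pointMult_set_bddBelow (he : BoxNonneg e) (u v : EReal) :
    BddBelow {n : ℤ | ∃ a b c d : EReal, LowerNhd a u ∧ UpperNhd u b ∧ LowerNhd c v ∧
      UpperNhd v d ∧ b ≤ c ∧ n = box e a b c d} := by
  refine ⟨0, ?_⟩
  rintro n ⟨a, b, c, d, ha, hb, hc, hd, hbc, rfl⟩
  exact he (ha.le.trans hb.le) hbc (hc.le.trans hd.le)

lemma pointMult_le_box (he : BoxNonneg e) {a b c d u v : EReal} (ha : LowerNhd a u)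
    (hb : UpperNhd u b) (hc : LowerNhd c v) (hd : UpperNhd v d) (hbc : b ≤ c) :
    pointMult e u v ≤ box e a b c d :=
  csInf_le (pointMult_set_bddBelow he u v) ⟨a, b, c, d, ha, hb, hc, hd, hbc, rfl⟩

lemma exists_box_eq_pointMult (he : BoxNonneg e) {u v : EReal} (huv : u < v) :
    ∃ a b c d : EReal, LowerNhd a u ∧ UpperNhd u b ∧ LowerNhd c v ∧ UpperNhd v d ∧
      b ≤ c ∧ box e a b c d = pointMult e u v := by
  obtain ⟨w, huw, hwv⟩ := exists_between huv
  have hne : {n : ℤ | ∃ a b c d : EReal, LowerNhd a u ∧ UpperNhd u b ∧ LowerNhd c v ∧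
      UpperNhd v d ∧ b ≤ c ∧ n = box e a b c d}.Nonempty :=
    ⟨_, ⊥, w, w, ⊤, Or.inr rfl, Or.inl huw, Or.inl hwv, Or.inr rfl, le_rfl, rfl⟩
  obtain ⟨a, b, c, d, ha, hb, hc, hd, hbc, h⟩ :=
    Int.csInf_mem hne (pointMult_set_bddBelow he u v)
  exact ⟨a, b, c, d, ha, hb, hc, hd, hbc, h.symm⟩

lemma pointMult_nonneg (he : BoxNonneg e) {u v : EReal} (huv : u < v) : 0 ≤ pointMult e u v := by
  obtain ⟨a, b, c, d, ha, hb, hc, hd, hbc, h⟩ := exists_box_eq_pointMult he huv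
  rw [← h]
  exact he (ha.le.trans hb.le) hbc (hc.le.trans hd.le)

/-- Between two different elements of a densely ordered set there is one outside a given
finite set. -/
lemma exists_between_notMem (S : Finset EReal) {x y : EReal} (h : x < y) :
    ∃ z, x < z ∧ z < y ∧ z ∉ S := by
  obtain ⟨z, hz, hzS⟩ := (Set.Ioo_infinite h).exists_notMem_finset S
  exact ⟨z, hz.1, hz.2, hzS⟩

/-- The multiplicities of finitely many points in a box add up to at most its alternating sum. -/
lemma sum_pointMult_le_box (he : BoxNonneg e) (T : Finset (EReal × EReal)) :
    ∀ {a b c d : EReal}, a ≤ b → b ≤ c → c ≤ d →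
      (∀ q ∈ T, LowerNhd a q.1 ∧ UpperNhd q.1 b ∧ LowerNhd c q.2 ∧ UpperNhd q.2 d) →
      ∑ q ∈ T, pointMult e q.1 q.2 ≤ box e a b c d := by
  classical
  induction T using Finset.strongInduction with
  | H T ih =>
    intro a b c d hab hbc hcd hT
    rcases T.eq_empty_or_nonempty with rfl | ⟨q, hq⟩
    · simpa using he hab hbc hcd
    by_cases hT' : T = {q}
    · subst hT'
      obtain ⟨h1, h2, h3, h4⟩ := hT q hq
      simpa using pointMult_le_box he h1 h2 h3 h4 hbc
    obtain ⟨q', hq', hne⟩ : ∃ q' ∈ T, q' ≠ q := by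
      by_contra hcon
      push Not at hcon
      exact hT' (Finset.eq_singleton_iff_unique_mem.2 ⟨hq, hcon⟩)
    -- Cut the box along a line that separates two points and misses all coordinates of points of
    -- `T`. Each point then has the half containing it as a neighbourhood, and both halves contain
    -- fewer points.
    have key : ∀ {x y : EReal × EReal}, x ∈ T → y ∈ T → x.1 < y.1 →
        ∑ q ∈ T, pointMult e q.1 q.2 ≤ box e a b c d := by
      intro x y hx hy hxy
      obtain ⟨z, hxz, hzy, hz⟩ := exists_between_notMem (T.image Prod.fst) hxy
      have hz' : ∀ w ∈ T, w.1 ≠ z := fun w hw h => hz (Finset.mem_image.2 ⟨w, hw, h⟩)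
      rw [← Finset.sum_filter_add_sum_filter_not T (fun w => w.1 < z)]
      have haz : a ≤ z := (hT x hx).1.le.trans hxz.le
      have hzb : z ≤ b := hzy.le.trans (hT y hy).2.1.le
      have h1 := ih (T.filter fun w => w.1 < z)
        (Finset.filter_ssubset.2 ⟨y, hy, not_lt.2 hzy.le⟩) haz (hzb.trans hbc) hcd
        (fun w hw => by
          obtain ⟨hw, hwz⟩ := Finset.mem_filter.1 hw
          exact ⟨(hT w hw).1, Or.inl hwz, (hT w hw).2.2⟩)
      have h2 := ih (T.filter fun w => ¬ w.1 < z)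
        (Finset.filter_ssubset.2 ⟨x, hx, not_not.2 hxz⟩) hzb hbc hcd
        (fun w hw => by
          obtain ⟨hw, hwz⟩ := Finset.mem_filter.1 hw
          exact ⟨Or.inl (lt_of_le_of_ne (not_lt.1 hwz) (hz' w hw).symm), (hT w hw).2⟩)
      unfold box at *
      linarith
    have key' : ∀ {x y : EReal × EReal}, x ∈ T → y ∈ T → x.2 < y.2 →
        ∑ q ∈ T, pointMult e q.1 q.2 ≤ box e a b c d := by
      intro x y hx hy hxy
      obtain ⟨z, hxz, hzy, hz⟩ := exists_between_notMem (T.image Prod.snd) hxy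
      have hz' : ∀ w ∈ T, w.2 ≠ z := fun w hw h => hz (Finset.mem_image.2 ⟨w, hw, h⟩)
      rw [← Finset.sum_filter_add_sum_filter_not T (fun w => w.2 < z)]
      have haz : c ≤ z := (hT x hx).2.2.1.le.trans hxz.le
      have hzb : z ≤ d := hzy.le.trans (hT y hy).2.2.2.le
      have h1 := ih (T.filter fun w => w.2 < z)
        (Finset.filter_ssubset.2 ⟨y, hy, not_lt.2 hzy.le⟩) hab hbc haz
        (fun w hw => by
          obtain ⟨hw, hwz⟩ := Finset.mem_filter.1 hw
          exact ⟨(hT w hw).1, (hT w hw).2.1, (hT w hw).2.2.1, Or.inl hwz⟩)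
      have h2 := ih (T.filter fun w => ¬ w.2 < z)
        (Finset.filter_ssubset.2 ⟨x, hx, not_not.2 hxz⟩) hab (hbc.trans haz) hzb
        (fun w hw => by
          obtain ⟨hw, hwz⟩ := Finset.mem_filter.1 hw
          exact ⟨(hT w hw).1, (hT w hw).2.1,
            Or.inl (lt_of_le_of_ne (not_lt.1 hwz) (hz' w hw).symm), (hT w hw).2.2.2⟩)
      unfold box at *
      linarith
    rcases lt_trichotomy q.1 q'.1 with h | h | h
    · exact key hq hq' h
    · rcases lt_trichotomy q.2 q'.2 with h' | h' | h'
      · exact key' hq hq' h'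
      · exact absurd (Prod.ext h h').symm hne
      · exact key' hq' hq h'
    · exact key hq' hq h

/-- Subadditivity of the increments of a monotone function. -/
lemma sub_le_sum_of_Ioc_subset {ι : Type*} (T : Finset ι) (l r : ι → EReal) {S : Set EReal}
    {g : EReal → ℤ} (hg : MonotoneOn g S) (hl : ∀ i ∈ T, l i ∈ S) (hr : ∀ i ∈ T, r i ∈ S)
    (hlr : ∀ i ∈ T, l i ≤ r i) {a b : EReal} (ha : a ∈ S) (hb : b ∈ S) (hab : a ≤ b)
    (hsub : ∀ x ∈ Set.Ioc a b, ∃ i ∈ T, x ∈ Set.Ioc (l i) (r i)) :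
    g b - g a ≤ ∑ i ∈ T, (g (r i) - g (l i)) := by
  classical
  induction T using Finset.strongInduction generalizing b with
  | H T ih =>
    have hnn : ∀ i ∈ T, 0 ≤ g (r i) - g (l i) := fun i hi =>
      sub_nonneg.2 (hg (hl i hi) (hr i hi) (hlr i hi))
    rcases hab.eq_or_lt with rfl | hab
    · simpa using Finset.sum_nonneg hnn
    obtain ⟨i, hi, hbi⟩ := hsub b ⟨hab, le_rfl⟩
    rw [← Finset.add_sum_erase T _ hi]
    have h1 := hg hb (hr i hi) hbi.2
    -- Either the interval containing `b` already reaches `a`, or it is removed and the rest must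
    -- cover the part up to its left end.
    rcases le_or_gt (l i) a with hla | hla
    · have h2 := hg (hl i hi) ha hla
      have h3 : 0 ≤ ∑ j ∈ T.erase i, (g (r j) - g (l j)) :=
        Finset.sum_nonneg fun j hj => hnn j (Finset.mem_of_mem_erase hj)
      linarith
    · have h2 := ih (T.erase i) (Finset.erase_ssubset hi)
        (fun j hj => hl j (Finset.mem_of_mem_erase hj))
        (fun j hj => hr j (Finset.mem_of_mem_erase hj))
        (fun j hj => hlr j (Finset.mem_of_mem_erase hj)) (hl i hi) hla.le
        (fun x hx => by
          obtain ⟨j, hj, hxj⟩ := hsub x ⟨hx.1, hx.2.trans hbi.1.le⟩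
          refine ⟨j, Finset.mem_erase.2 ⟨?_, hj⟩, hxj⟩
          rintro rfl
          exact absurd hxj.1 (not_lt.2 hx.2))
      linarith

/-- A compact interval covered by neighbourhoods of its points is contained, together with a
neighbourhood, in the union of finitely many of them. -/
lemma exists_finset_cover_Icc {a b : EReal} (hab : a ≤ b) (l r : EReal → EReal)
    (hl : ∀ u ∈ Set.Icc a b, LowerNhd (l u) u) (hr : ∀ u ∈ Set.Icc a b, UpperNhd u (r u)) :
    ∃ T : Finset EReal, (∀ u ∈ T, u ∈ Set.Icc a b) ∧ (∃ u ∈ T, LowerNhd (l u) a ∧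
      ∃ u' ∈ T, UpperNhd b (r u') ∧
        ∀ x ∈ Set.Ioc (l u) (r u'), ∃ i ∈ T, x ∈ Set.Ioc (l i) (r i)) := by
  have hU : ∀ u ∈ Set.Icc a b, Set.Icc (l u) (r u) ∈ 𝓝 u := fun u hu =>
    Icc_mem_nhds_of (hl u hu) (hr u hu)
  obtain ⟨T, hT, hcov⟩ := isCompact_Icc.elim_nhds_subcover
    (fun u => interior (Set.Icc (l u) (r u))) (fun u hu => interior_mem_nhds.2 (hU u hu))
  have hcov' : ∀ x ∈ Set.Icc a b, ∃ u ∈ T, LowerNhd (l u) x ∧ UpperNhd x (r u) := by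
    intro x hx
    obtain ⟨u, hu, hxu⟩ := Set.mem_iUnion₂.1 (hcov hx)
    have := mem_interior_iff_mem_nhds.1 hxu
    exact ⟨u, hu, lowerNhd_of_mem (Filter.mem_of_superset this Set.Icc_subset_Ici_self),
      upperNhd_of_mem (Filter.mem_of_superset this Set.Icc_subset_Iic_self)⟩
  obtain ⟨u, hu, hua, hua'⟩ := hcov' a ⟨le_rfl, hab⟩
  obtain ⟨u', hu', hub, hub'⟩ := hcov' b ⟨hab, le_rfl⟩
  refine ⟨T, hT, u, hu, hua, u', hu', hub', ?_⟩
  intro x hx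
  rcases lt_or_ge x a with hxa | hxa
  · exact ⟨u, hu, hx.1, hxa.le.trans hua'.le⟩
  rcases le_or_gt x b with hxb | hxb
  · obtain ⟨i, hi, h1, h2⟩ := hcov' x ⟨hxa, hxb⟩
    refine ⟨i, hi, ?_, h2.le⟩
    rcases h1 with h1 | h1
    · exact h1
    · rw [h1]; exact bot_le.trans_lt hx.1
  · exact ⟨u', hu', hub.le.trans_lt hxb, hx.2⟩

/-- Around a vertical segment there is a box whose alternating sum is at most the sum of the
multiplicities of finitely many points of the segment. -/
lemma exists_box_le_sum_of_segment (he : BoxNonneg e) {u c d : EReal} (huc : u < c)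
    (hcd : c ≤ d) :
    ∃ l r c' d' : EReal, LowerNhd l u ∧ UpperNhd u r ∧ LowerNhd c' c ∧ UpperNhd d d' ∧ r ≤ c' ∧
      ∃ T : Finset EReal, (∀ v ∈ T, v ∈ Set.Icc c d) ∧
        box e l r c' d' ≤ ∑ v ∈ T, pointMult e u v := by
  have hbox : ∀ v : EReal, ∃ l r γ δ : EReal, v ∈ Set.Icc c d → LowerNhd l u ∧ UpperNhd u r ∧
      LowerNhd γ v ∧ UpperNhd v δ ∧ r ≤ γ ∧ box e l r γ δ = pointMult e u v := by
    intro v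
    by_cases hv : v ∈ Set.Icc c d
    · obtain ⟨l, r, γ, δ, h⟩ := exists_box_eq_pointMult he (huc.trans_le hv.1)
      exact ⟨l, r, γ, δ, fun _ => h⟩
    · exact ⟨⊥, ⊥, ⊥, ⊥, fun h => absurd h hv⟩
  choose l r γ δ h using hbox
  obtain ⟨T, hT, v₀, hv₀, hc', v₁, hv₁, hd', hcov⟩ := exists_finset_cover_Icc hcd γ δ
    (fun v hv => (h v hv).2.2.1) (fun v hv => (h v hv).2.2.2.1)
  -- Intersecting the finitely many horizontal sides gives one side that works for all boxes of the
  -- cover.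
  have hl : LowerNhd (T.sup l) u := LowerNhd.finset_sup fun v hv => (h v (hT v hv)).1
  have hr : UpperNhd u (T.inf r) := UpperNhd.finset_inf fun v hv => (h v (hT v hv)).2.1
  have hrγ : ∀ v ∈ T, T.inf r ≤ γ v := fun v hv =>
    (Finset.inf_le hv).trans (h v (hT v hv)).2.2.2.2.1
  have hγδ : ∀ v ∈ T, γ v ≤ δ v := fun v hv =>
    (h v (hT v hv)).2.2.1.le.trans (h v (hT v hv)).2.2.2.1.le
  have hlr : T.sup l ≤ T.inf r := hl.le.trans hr.le
  have hcd' : γ v₀ ≤ δ v₁ := hc'.le.trans (hcd.trans hd'.le)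
  refine ⟨T.sup l, T.inf r, γ v₀, δ v₁, hl, hr, hc', hd', hrγ v₀ hv₀, T, hT, ?_⟩
  -- With the horizontal side fixed, the alternating sum is an increment of a monotone function of
  -- the vertical coordinate, so the covering estimate becomes one-dimensional.
  have hg : MonotoneOn (fun y => e (T.sup l) y - e (T.inf r) y) (Set.Ici (T.inf r)) := by
    intro y hy y' _ hyy'
    have := he hlr hy hyy'
    unfold box at this
    dsimp only
    linarith
  have h1 := sub_le_sum_of_Ioc_subset T γ δ hg hrγ (fun v hv => (hrγ v hv).trans (hγδ v hv)) hγδ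
    (hrγ v₀ hv₀) ((hrγ v₀ hv₀).trans hcd') hcd' hcov
  calc box e (T.sup l) (T.inf r) (γ v₀) (δ v₁) ≤ ∑ v ∈ T, box e (T.sup l) (T.inf r) (γ v) (δ v) := by
        unfold box
        refine le_trans (le_of_eq ?_) (h1.trans (Finset.sum_le_sum fun v _ => le_of_eq ?_)) <;> ring
    _ ≤ ∑ v ∈ T, pointMult e u v := by
        refine Finset.sum_le_sum fun v hv => ?_
        obtain ⟨-, -, -, -, h5, h6⟩ := h v (hT v hv)
        rw [← h6]
        exact he.box_mono (Finset.le_sup hv) hlr (Finset.inf_le hv) h5 le_rfl (hγδ v hv) le_rfl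

/-- Around a closed rectangle there is a box whose alternating sum is at most the sum of the
multiplicities of finitely many points of the rectangle. -/
lemma exists_box_le_sum (he : BoxNonneg e) {a b c d : EReal} (hab : a ≤ b) (hbc : b < c)
    (hcd : c ≤ d) :
    ∃ a' b' c' d' : EReal, LowerNhd a' a ∧ UpperNhd b b' ∧ LowerNhd c' c ∧ UpperNhd d d' ∧
      b' ≤ c' ∧ ∃ T : Finset (EReal × EReal), (∀ q ∈ T, q.1 ∈ Set.Icc a b ∧ q.2 ∈ Set.Icc c d) ∧
        box e a' b' c' d' ≤ ∑ q ∈ T, pointMult e q.1 q.2 := by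
  have hbox : ∀ u : EReal, ∃ l r γ δ : EReal, ∃ T : Finset EReal, u ∈ Set.Icc a b →
      LowerNhd l u ∧ UpperNhd u r ∧ LowerNhd γ c ∧ UpperNhd d δ ∧ r ≤ γ ∧
        (∀ v ∈ T, v ∈ Set.Icc c d) ∧ box e l r γ δ ≤ ∑ v ∈ T, pointMult e u v := by
    intro u
    by_cases hu : u ∈ Set.Icc a b
    · obtain ⟨l, r, γ, δ, h1, h2, h3, h4, h5, T, h⟩ :=
        exists_box_le_sum_of_segment he (hu.2.trans_lt hbc) hcd
      exact ⟨l, r, γ, δ, T, fun _ => ⟨h1, h2, h3, h4, h5, h⟩⟩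
    · exact ⟨⊥, ⊥, ⊥, ⊥, ∅, fun h => absurd h hu⟩
  choose l r γ δ V h using hbox
  obtain ⟨T, hT, u₀, hu₀, ha', u₁, hu₁, hb', hcov⟩ := exists_finset_cover_Icc hab l r
    (fun u hu => (h u hu).1) (fun u hu => (h u hu).2.1)
  have hγ : LowerNhd (T.sup γ) c := LowerNhd.finset_sup fun u hu => (h u (hT u hu)).2.2.1
  have hδ : UpperNhd d (T.inf δ) := UpperNhd.finset_inf fun u hu => (h u (hT u hu)).2.2.2.1
  have hrγ : ∀ u ∈ T, r u ≤ T.sup γ := fun u hu =>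
    (h u (hT u hu)).2.2.2.2.1.trans (Finset.le_sup hu)
  have hlr : ∀ u ∈ T, l u ≤ r u := fun u hu =>
    (h u (hT u hu)).1.le.trans (h u (hT u hu)).2.1.le
  have hγδ : T.sup γ ≤ T.inf δ := hγ.le.trans (hcd.trans hδ.le)
  have hab' : l u₀ ≤ r u₁ := ha'.le.trans (hab.trans hb'.le)
  refine ⟨l u₀, r u₁, T.sup γ, T.inf δ, ha', hb', hγ, hδ, hrγ u₁ hu₁,
    (T.sigma V).map (Equiv.sigmaEquivProd EReal EReal).toEmbedding, ?_, ?_⟩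
  · intro q hq
    obtain ⟨⟨x, y⟩, hx, rfl⟩ := Finset.mem_map.1 hq
    obtain ⟨hx, hy⟩ := Finset.mem_sigma.1 hx
    exact ⟨hT x hx, (h x (hT x hx)).2.2.2.2.2.1 y hy⟩
  have hg : MonotoneOn (fun x => e x (T.sup γ) - e x (T.inf δ)) (Set.Iic (T.sup γ)) := by
    intro x _ x' hx' hxx'
    have := he hxx' hx' hγδ
    unfold box at this
    dsimp only
    linarith
  have h1 := sub_le_sum_of_Ioc_subset T l r hg (fun u hu => (hlr u hu).trans (hrγ u hu)) hrγ hlr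
    (hab'.trans (hrγ u₁ hu₁)) (hrγ u₁ hu₁) hab' hcov
  rw [Finset.sum_map, Finset.sum_sigma]
  calc box e (l u₀) (r u₁) (T.sup γ) (T.inf δ)
      ≤ ∑ u ∈ T, box e (l u) (r u) (T.sup γ) (T.inf δ) := by
        unfold box
        refine le_trans (le_of_eq ?_) (h1.trans (Finset.sum_le_sum fun v _ => le_of_eq ?_)) <;> ring
    _ ≤ ∑ u ∈ T, ∑ v ∈ V u, pointMult e u v := by
        refine Finset.sum_le_sum fun u hu => ?_
        obtain ⟨-, -, h3, h4, h5, -, h6⟩ := h u (hT u hu)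
        exact (he.box_mono le_rfl (hlr u hu) le_rfl h5 (Finset.le_sup hu) hγδ
          (Finset.inf_le hu)).trans h6

end

/-! ### Closed balls in `[-∞, ∞]` -/

/-- `w` lies in the closed interval `[u - δ, u + δ]`. -/
def Near (δ : ℝ) (u w : EReal) : Prop := u - δ ≤ w ∧ w ≤ u + δ

lemma near_coe {δ x y : ℝ} : Near δ (x : EReal) (y : EReal) ↔ |x - y| ≤ δ := by
  unfold Near
  norm_cast
  rw [abs_le]
  constructor
  · rintro ⟨h1, h2⟩; constructor <;> linarith
  · rintro ⟨h1, h2⟩; constructor <;> linarith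

lemma near_bot {δ : ℝ} {w : EReal} : Near δ ⊥ w ↔ w = ⊥ := by simp [Near]

lemma near_top {δ : ℝ} {w : EReal} : Near δ ⊤ w ↔ w = ⊤ := by simp [Near]

lemma not_near_coe_bot {δ x : ℝ} : ¬ Near δ (x : EReal) ⊥ := by
  rintro ⟨h, -⟩
  exact absurd (le_bot_iff.1 h) (by norm_cast)

lemma not_near_coe_top {δ x : ℝ} : ¬ Near δ (x : EReal) ⊤ := by
  rintro ⟨-, h⟩
  exact absurd (top_le_iff.1 h) (by norm_cast)

lemma Near.symm {δ : ℝ} {u w : EReal} (h : Near δ u w) : Near δ w u := by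
  induction u using EReal.rec with
  | bot => rw [near_bot] at h; subst h; exact near_bot.2 rfl
  | top => rw [near_top] at h; subst h; exact near_top.2 rfl
  | coe x =>
    induction w using EReal.rec with
    | bot => exact absurd h not_near_coe_bot
    | top => exact absurd h not_near_coe_top
    | coe y => rw [near_coe] at *; rwa [abs_sub_comm]

lemma Near.trans {δ δ' : ℝ} {u w z : EReal} (h : Near δ u w) (h' : Near δ' w z) :
    Near (δ + δ') u z := by
  induction u using EReal.rec with
  | bot => rw [near_bot] at h; subst h; rw [near_bot] at *; exact h'
  | top => rw [near_top] at h; subst h; rw [near_top] at *; exact h'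
  | coe x =>
    induction w using EReal.rec with
    | bot => exact absurd h not_near_coe_bot
    | top => exact absurd h not_near_coe_top
    | coe y =>
      induction z using EReal.rec with
      | bot => exact absurd h' not_near_coe_bot
      | top => exact absurd h' not_near_coe_top
      | coe z =>
        rw [near_coe] at *
        exact (abs_sub_le x y z).trans (add_le_add h h')

lemma Near.mono {δ δ' : ℝ} {u w : EReal} (h : Near δ u w) (hδ : δ ≤ δ') : Near δ' u w :=
  ⟨(EReal.sub_le_sub le_rfl (EReal.coe_le_coe_iff.2 hδ)).trans h.1,
    h.2.trans (add_le_add le_rfl (EReal.coe_le_coe_iff.2 hδ))⟩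

lemma near_refl {δ : ℝ} (hδ : 0 ≤ δ) (u : EReal) : Near δ u u := by
  induction u using EReal.rec with
  | bot => exact near_bot.2 rfl
  | top => exact near_top.2 rfl
  | coe x => rw [near_coe]; simpa using hδ

lemma exists_not_near {u w : EReal} (h : u ≠ w) : ∃ r : ℝ, 0 < r ∧ ¬ Near r u w := by
  induction u using EReal.rec with
  | bot => exact ⟨1, one_pos, fun h' => h (near_bot.1 h').symm⟩
  | top => exact ⟨1, one_pos, fun h' => h (near_top.1 h').symm⟩
  | coe x =>
    induction w using EReal.rec with
    | bot => exact ⟨1, one_pos, not_near_coe_bot⟩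
    | top => exact ⟨1, one_pos, not_near_coe_top⟩
    | coe y =>
      have hxy : 0 < |x - y| := abs_pos.2 (sub_ne_zero.2 fun h' => h (by rw [h']))
      exact ⟨|x - y| / 2, by linarith, fun h' => by rw [near_coe] at h'; linarith⟩

/-- `z` lies in the closed square of radius `δ` around `q`. -/
def Near₂ (δ : ℝ) (q z : EReal × EReal) : Prop := Near δ q.1 z.1 ∧ Near δ q.2 z.2

lemma Near₂.symm {δ : ℝ} {u w : EReal × EReal} (h : Near₂ δ u w) : Near₂ δ w u :=
  ⟨h.1.symm, h.2.symm⟩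

lemma Near₂.trans {δ δ' : ℝ} {u w z : EReal × EReal} (h : Near₂ δ u w) (h' : Near₂ δ' w z) :
    Near₂ (δ + δ') u z :=
  ⟨h.1.trans h'.1, h.2.trans h'.2⟩

lemma Near₂.mono {δ δ' : ℝ} {u w : EReal × EReal} (h : Near₂ δ u w) (hδ : δ ≤ δ') :
    Near₂ δ' u w :=
  ⟨h.1.mono hδ, h.2.mono hδ⟩

lemma exists_not_near₂ {u w : EReal × EReal} (h : u ≠ w) : ∃ r : ℝ, 0 < r ∧ ¬ Near₂ r u w := by
  by_cases h1 : u.1 = w.1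
  · obtain ⟨r, hr, h'⟩ := exists_not_near fun h2 => h (Prod.ext h1 h2)
    exact ⟨r, hr, fun hn => h' hn.2⟩
  · obtain ⟨r, hr, h'⟩ := exists_not_near h1
    exact ⟨r, hr, fun hn => h' hn.1⟩

lemma exists_pos_forall_le {ι : Type*} (T : Finset ι) {r : ι → ℝ} (hr : ∀ i ∈ T, 0 < r i) :
    ∃ δ : ℝ, 0 < δ ∧ ∀ i ∈ T, δ ≤ r i := by
  rcases T.eq_empty_or_nonempty with rfl | hT
  · exact ⟨1, one_pos, by simp⟩
  · exact ⟨T.inf' hT r, (Finset.lt_inf'_iff hT).2 hr, fun i hi => Finset.inf'_le r hi⟩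

lemma exists_pos_forall_not_near₂ (T : Finset (EReal × EReal)) :
    ∃ r : ℝ, 0 < r ∧ ∀ z ∈ T, ∀ w ∈ T, z ≠ w → ¬ Near₂ r z w := by
  classical
  have h : ∀ x : (EReal × EReal) × (EReal × EReal), ∃ r : ℝ, 0 < r ∧
      (x.1 ≠ x.2 → ¬ Near₂ r x.1 x.2) := by
    intro x
    by_cases hx : x.1 = x.2
    · exact ⟨1, one_pos, fun h => absurd hx h⟩
    · obtain ⟨r, hr, h⟩ := exists_not_near₂ hx
      exact ⟨r, hr, fun _ => h⟩
  choose r hr h using h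
  obtain ⟨δ, hδ, hδr⟩ : ∃ δ : ℝ, 0 < δ ∧ ∀ x ∈ T ×ˢ T, δ ≤ r x :=
    exists_pos_forall_le (T ×ˢ T) fun x _ => hr x
  exact ⟨δ, hδ, fun z hz w hw hzw hn =>
    h (z, w) hzw (hn.mono (hδr (z, w) (Finset.mk_mem_product hz hw)))⟩

/-- This leaves room at an endpoint: a box with the new endpoints can be enlarged by a small `δ`
without leaving the old box. An endpoint `⊥` needs no room, because shifts fix it. -/
lemma LowerNhd.exists_sub {a u : EReal} (h : LowerNhd a u) :
    ∃ a' : EReal, ∃ r : ℝ, 0 < r ∧ LowerNhd a' u ∧ ∀ δ : ℝ, δ ≤ r → a ≤ a' - δ := by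
  rcases h with h | rfl
  · obtain ⟨y, hay, hyu⟩ := EReal.lt_iff_exists_real_btwn.1 h
    obtain ⟨x, hax, hxy⟩ := EReal.lt_iff_exists_real_btwn.1 hay
    have hxy' : x < y := by exact_mod_cast hxy
    refine ⟨y, y - x, sub_pos.2 hxy', Or.inl hyu, fun δ hδ => hax.le.trans ?_⟩
    norm_cast
    linarith
  · exact ⟨⊥, 1, one_pos, Or.inr rfl, fun _ _ => bot_le⟩

lemma UpperNhd.exists_add {b u : EReal} (h : UpperNhd u b) :
    ∃ b' : EReal, ∃ r : ℝ, 0 < r ∧ UpperNhd u b' ∧ ∀ δ : ℝ, δ ≤ r → b' + δ ≤ b := by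
  rcases h with h | rfl
  · obtain ⟨y, huy, hyb⟩ := EReal.lt_iff_exists_real_btwn.1 h
    obtain ⟨x, hyx, hxb⟩ := EReal.lt_iff_exists_real_btwn.1 hyb
    have hxy' : y < x := by exact_mod_cast hyx
    refine ⟨y, x - y, sub_pos.2 hxy', Or.inl huy, fun δ hδ => le_trans ?_ hxb.le⟩
    norm_cast
    linarith
  · exact ⟨⊤, 1, one_pos, Or.inr rfl, fun _ _ => le_top⟩

lemma LowerNhd.add_coe {a u : EReal} {δ : ℝ} (h : LowerNhd a (u - δ)) : LowerNhd (a + δ) u := by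
  rcases h with h | rfl
  · exact Or.inl (EReal.add_lt_of_lt_sub h)
  · exact Or.inr (EReal.bot_add _)

lemma UpperNhd.sub_coe {b u : EReal} {δ : ℝ} (h : UpperNhd (u + δ) b) : UpperNhd u (b - δ) := by
  rcases h with h | rfl
  · exact Or.inl ((EReal.lt_sub_iff_add_lt (Or.inl (EReal.coe_ne_bot _))
      (Or.inl (EReal.coe_ne_top _))).2 h)
  · exact Or.inr (EReal.top_sub_coe _)

/-! ### One-parameter families -/

/-- A family of functions `e s`, `0 ≤ s ≤ ε`, whose boxes satisfy the box inequality. -/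
structure BoxFlow (ε : ℝ) (e : ℝ → EReal → EReal → ℤ) : Prop where
  nonneg : ∀ s, 0 ≤ s → s ≤ ε → BoxNonneg (e s)
  box_le : ∀ s t : ℝ, 0 ≤ s → s ≤ t → t ≤ ε → ∀ a b c d : EReal, a ≤ b → c ≤ d →
    b + (t - s : ℝ) ≤ c - (t - s : ℝ) →
      box (e s) a b c d ≤ box (e t) (a - (t - s : ℝ)) (b + (t - s : ℝ))
        (c - (t - s : ℝ)) (d + (t - s : ℝ))

variable {ε : ℝ} {e : ℝ → EReal → EReal → ℤ}

/-- At time `s` the closed `s`-neighbourhood of `A` contains points of total multiplicity at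
least `n`. -/
def HasMass (e : ℝ → EReal → EReal → ℤ) (A : Finset (EReal × EReal)) (n : ℤ) (s : ℝ) : Prop :=
  ∃ T : Finset (EReal × EReal), (∀ z ∈ T, ∃ q ∈ A, Near₂ s q z) ∧
    n ≤ ∑ z ∈ T, pointMult (e s) z.1 z.2

/-- Semicontinuity from the left. A box realising the multiplicity at time `s` is shrunk slightly;
for `t` just below `s`, the box inequality enlarges the shrunk box by `s - t`, which keeps it inside
the realising box. -/
lemma BoxFlow.exists_box_le_pointMult (h : BoxFlow ε e) {s : ℝ} (hsε : s ≤ ε)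
    {u v : EReal} (huv : u < v) :
    ∃ a b c d : EReal, ∃ r : ℝ, 0 < r ∧ LowerNhd a u ∧ UpperNhd u b ∧ LowerNhd c v ∧
      UpperNhd v d ∧ ∀ t, 0 ≤ t → t ≤ s → s - t ≤ r →
        b ≤ c ∧ box (e t) a b c d ≤ pointMult (e s) u v := by
  rcases lt_or_ge s 0 with hs | hs
  · exact ⟨⊥, ⊤, ⊥, ⊤, 1, one_pos, Or.inr rfl, Or.inr rfl, Or.inr rfl, Or.inr rfl,
      fun t h0 hts => absurd (h0.trans hts) (not_le.2 hs)⟩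
  obtain ⟨a, b, c, d, ha, hb, hc, hd, hbc, hm⟩ := exists_box_eq_pointMult (h.nonneg s hs hsε) huv
  obtain ⟨a', r₁, hr₁, ha', h₁⟩ := ha.exists_sub
  obtain ⟨b', r₂, hr₂, hb', h₂⟩ := hb.exists_add
  obtain ⟨c', r₃, hr₃, hc', h₃⟩ := hc.exists_sub
  obtain ⟨d', r₄, hr₄, hd', h₄⟩ := hd.exists_add
  refine ⟨a', b', c', d', min (min r₁ r₂) (min r₃ r₄), by positivity, ha', hb', hc', hd', ?_⟩
  intro t ht hts hr
  simp only [le_min_iff] at hr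
  obtain ⟨⟨g1, g2⟩, g3, g4⟩ := hr
  have hδ : (0 : EReal) ≤ (s - t : ℝ) := by exact_mod_cast sub_nonneg.2 hts
  have hbc' : b' + (s - t : ℝ) ≤ c' - (s - t : ℝ) := (h₂ _ g2).trans (hbc.trans (h₃ _ g3))
  have hbb : b' ≤ b' + (s - t : ℝ) := le_add_of_nonneg_right hδ
  have hcc : c' - (s - t : ℝ) ≤ c' := EReal.sub_le_of_le_add (le_add_of_nonneg_right hδ)
  have haa : a' - (s - t : ℝ) ≤ a' := EReal.sub_le_of_le_add (le_add_of_nonneg_right hδ)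
  have hdd : d' ≤ d' + (s - t : ℝ) := le_add_of_nonneg_right hδ
  refine ⟨hbb.trans (hbc'.trans hcc), ?_⟩
  rw [← hm]
  refine (h.box_le t s ht hts hsε a' b' c' d' (ha'.le.trans hb'.le) (hc'.le.trans hd'.le)
    hbc').trans ?_
  exact (h.nonneg s hs hsε).box_mono (h₁ _ g1) (haa.trans ((ha'.le.trans hb'.le).trans hbb))
    (h₂ _ g2) hbc (h₃ _ g3) (hcc.trans ((hc'.le.trans hd'.le).trans hdd)) (h₄ _ g4)

/-- The closed square of radius `t - s` around `(u, v)` lies in a box whose sum at time `t` is at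
most the mass of finitely many points of the square. Shrunk by `t - s`, that box is still a
neighbourhood of `(u, v)`, so the box inequality applies. -/
lemma BoxFlow.pointMult_le_sum (h : BoxFlow ε e) {s t : ℝ} (hs : 0 ≤ s) (hst : s ≤ t)
    (htε : t ≤ ε) {u v : EReal} (huv : u + (t - s : ℝ) < v - (t - s : ℝ)) :
    ∃ T : Finset (EReal × EReal), (∀ z ∈ T, Near₂ (t - s) (u, v) z) ∧
      pointMult (e s) u v ≤ ∑ z ∈ T, pointMult (e t) z.1 z.2 := by
  have hδ : (0 : EReal) ≤ (t - s : ℝ) := by exact_mod_cast sub_nonneg.2 hst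
  have hle : ∀ x : EReal, x - (t - s : ℝ) ≤ x + (t - s : ℝ) := fun x =>
    (EReal.sub_le_of_le_add (le_add_of_nonneg_right hδ)).trans (le_add_of_nonneg_right hδ)
  obtain ⟨a, b, c, d, ha, hb, hc, hd, hbc, T, hT, hm⟩ :=
    exists_box_le_sum (h.nonneg t (hs.trans hst) htε) (hle u) huv (hle v)
  refine ⟨T, fun z hz => hT z hz, le_trans ?_ hm⟩
  have hbc' : b - (t - s : ℝ) ≤ c + (t - s : ℝ) :=
    (EReal.sub_le_sub hbc le_rfl).trans (hle c)
  refine (pointMult_le_box (h.nonneg s hs (hst.trans htε)) ha.add_coe hb.sub_coe hc.add_coe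
    hd.sub_coe hbc').trans ?_
  have := h.box_le s t hs hst htε (a + (t - s : ℝ)) (b - (t - s : ℝ)) (c + (t - s : ℝ))
    (d - (t - s : ℝ)) (ha.add_coe.le.trans hb.sub_coe.le) (hc.add_coe.le.trans hd.sub_coe.le)
    (by rwa [EReal.sub_add_cancel, EReal.add_sub_cancel_right])
  rwa [EReal.sub_add_cancel, EReal.add_sub_cancel_right, EReal.sub_add_cancel,
    EReal.add_sub_cancel_right] at this

lemma lt_of_near₂ {q z : EReal × EReal} (hq : q.1 + ε < q.2 - ε) {s : ℝ} (hs : s ≤ ε)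
    (h : Near₂ s q z) : z.1 < z.2 :=
  ((h.mono hs).1.2.trans_lt hq).trans_le (h.mono hs).2.1

variable {A : Finset (EReal × EReal)} {n : ℤ}

/-- The closed `s`-neighbourhood of `A` is compact, hence covered by finitely many boxes, each with
sum at time `t` at most the multiplicity of its centre at time `s`. Mass present at time `t` is thus
dominated by the mass of the centres at time `s`. -/
lemma BoxFlow.exists_hasMass_of_left (h : BoxFlow ε e) (hA : ∀ q ∈ A, q.1 + ε < q.2 - ε)
    {s : ℝ} (hsε : s ≤ ε) :
    ∃ r : ℝ, 0 < r ∧ ∀ t, 0 ≤ t → t ≤ s → s - t ≤ r → HasMass e A n t → HasMass e A n s := by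
  classical
  set K : Set (EReal × EReal) := ⋃ q ∈ A,
    (Set.Icc (q.1 - s) (q.1 + s)) ×ˢ (Set.Icc (q.2 - s) (q.2 + s)) with hK
  have hmemK : ∀ z, z ∈ K ↔ ∃ q ∈ A, Near₂ s q z := by
    intro z
    simp only [hK, Set.mem_iUnion, Set.mem_prod, Set.mem_Icc, exists_prop, Near₂, Near]
  have hKc : IsCompact K := A.isCompact_biUnion fun q _ => isCompact_Icc.prod isCompact_Icc
  have hKlt : ∀ z ∈ K, z.1 < z.2 := by
    intro z hz
    obtain ⟨q, hq, hqz⟩ := (hmemK z).1 hz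
    exact lt_of_near₂ (hA q hq) hsε hqz
  have hbox : ∀ z : EReal × EReal, ∃ a b c d : EReal, ∃ r : ℝ, 0 < r ∧ (z ∈ K →
      LowerNhd a z.1 ∧ UpperNhd z.1 b ∧ LowerNhd c z.2 ∧
      UpperNhd z.2 d ∧ ∀ t, 0 ≤ t → t ≤ s → s - t ≤ r →
        b ≤ c ∧ box (e t) a b c d ≤ pointMult (e s) z.1 z.2) := by
    intro z
    by_cases hz : z ∈ K
    · obtain ⟨a, b, c, d, r, hr, h'⟩ := h.exists_box_le_pointMult hsε (hKlt z hz)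
      exact ⟨a, b, c, d, r, hr, fun _ => h'⟩
    · exact ⟨⊥, ⊥, ⊥, ⊥, 1, one_pos, fun h => absurd h hz⟩
  choose a b c d r hr hz using hbox
  obtain ⟨T₀, hT₀, hcov⟩ := hKc.elim_nhds_subcover
    (fun z => interior (Set.Icc (a z) (b z)) ×ˢ interior (Set.Icc (c z) (d z))) (fun z hzK => by
      obtain ⟨h1, h2, h3, h4, -⟩ := hz z hzK
      exact prod_mem_nhds (interior_mem_nhds.2 (Icc_mem_nhds_of h1 h2))
        (interior_mem_nhds.2 (Icc_mem_nhds_of h3 h4)))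
  obtain ⟨δ, hδ, hδr⟩ : ∃ δ : ℝ, 0 < δ ∧ ∀ z ∈ T₀, δ ≤ r z :=
    exists_pos_forall_le T₀ fun z _ => hr z
  refine ⟨δ, hδ, ?_⟩
  rintro t ht hts hst ⟨T, hT, hn⟩
  refine ⟨T₀, fun z hz => (hmemK z).1 (hT₀ z hz), hn.trans ?_⟩
  have hTlt : ∀ w ∈ T, 0 ≤ pointMult (e t) w.1 w.2 := by
    intro w hw
    obtain ⟨q, hq, hqw⟩ := hT w hw
    exact pointMult_nonneg (h.nonneg t ht (hts.trans hsε))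
      (lt_of_near₂ (hA q hq) (hts.trans hsε) hqw)
  set P : EReal × EReal → EReal × EReal → Prop := fun z w =>
    w ∈ interior (Set.Icc (a z) (b z)) ×ˢ interior (Set.Icc (c z) (d z)) with hP
  have hnn : ∀ w ∈ T, ∀ z ∈ T₀, 0 ≤ if P z w then pointMult (e t) w.1 w.2 else 0 := by
    intro w hw z _
    split_ifs
    exacts [hTlt w hw, le_rfl]
  calc ∑ w ∈ T, pointMult (e t) w.1 w.2
      ≤ ∑ w ∈ T, ∑ z ∈ T₀, if P z w then pointMult (e t) w.1 w.2 else 0 := by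
        refine Finset.sum_le_sum fun w hw => ?_
        obtain ⟨q, hq, hqw⟩ := hT w hw
        obtain ⟨z, hz, hzw⟩ := Set.mem_iUnion₂.1 (hcov ((hmemK w).2 ⟨q, hq, hqw.mono hts⟩))
        refine le_trans (le_of_eq ?_) (Finset.single_le_sum (hnn w hw) hz)
        exact (if_pos hzw).symm
    _ = ∑ z ∈ T₀, ∑ w ∈ T.filter (P z), pointMult (e t) w.1 w.2 := by
        rw [Finset.sum_comm]
        exact Finset.sum_congr rfl fun z _ => (Finset.sum_filter _ _).symm
    _ ≤ ∑ z ∈ T₀, pointMult (e s) z.1 z.2 := by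
        refine Finset.sum_le_sum fun z hzT => ?_
        obtain ⟨h1, h2, h3, h4, h5⟩ := hz z (hT₀ z hzT)
        obtain ⟨h5, h6⟩ := h5 t ht hts (hst.trans (hδr z hzT))
        refine (sum_pointMult_le_box (h.nonneg t ht (hts.trans hsε)) _ (h1.le.trans h2.le) h5
          (h3.le.trans h4.le) ?_).trans h6
        intro w hw
        obtain ⟨hw1, hw2⟩ := (Finset.mem_filter.1 hw).2
        have hw1 := mem_interior_iff_mem_nhds.1 hw1
        have hw2 := mem_interior_iff_mem_nhds.1 hw2
        exact ⟨lowerNhd_of_mem (Filter.mem_of_superset hw1 Set.Icc_subset_Ici_self),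
          upperNhd_of_mem (Filter.mem_of_superset hw1 Set.Icc_subset_Iic_self),
          lowerNhd_of_mem (Filter.mem_of_superset hw2 Set.Icc_subset_Ici_self),
          upperNhd_of_mem (Filter.mem_of_superset hw2 Set.Icc_subset_Iic_self)⟩

/-- The finitely many points carrying the mass are separated, so for small `t - s` the squares of
radius `t - s` around them share no point and nothing is counted twice. -/
lemma BoxFlow.exists_hasMass_of_right (h : BoxFlow ε e) (hA : ∀ q ∈ A, q.1 + ε < q.2 - ε)
    {s : ℝ} (hs : 0 ≤ s) (hm : HasMass e A n s) :
    ∃ r : ℝ, 0 < r ∧ ∀ t, s ≤ t → t ≤ ε → t - s ≤ r → HasMass e A n t := by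
  classical
  obtain ⟨T, hT, hn⟩ := hm
  obtain ⟨r, hr, hsep⟩ := exists_pos_forall_not_near₂ T
  refine ⟨r / 2, by positivity, fun t hst htε htr => ?_⟩
  have hgap : ∀ z ∈ T, z.1 + (t - s : ℝ) < z.2 - (t - s : ℝ) := by
    intro z hz
    obtain ⟨q, hq, hqz⟩ := hT z hz
    have e1 : q.1 + s + (t - s : ℝ) = q.1 + t := by
      rw [add_assoc]; norm_cast; rw [add_sub_cancel]
    have e2 : q.2 - s - (t - s : ℝ) = q.2 - t := by
      rw [sub_eq_add_neg, sub_eq_add_neg, sub_eq_add_neg, add_assoc]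
      norm_cast
      congr 2
      ring
    calc z.1 + (t - s : ℝ) ≤ q.1 + t := e1 ▸ add_le_add hqz.1.2 le_rfl
      _ ≤ q.1 + ε := add_le_add le_rfl (EReal.coe_le_coe_iff.2 htε)
      _ < q.2 - ε := hA q hq
      _ ≤ q.2 - t := EReal.sub_le_sub le_rfl (EReal.coe_le_coe_iff.2 htε)
      _ ≤ z.2 - (t - s : ℝ) := e2 ▸ EReal.sub_le_sub hqz.2.1 le_rfl
  have hex : ∀ z : EReal × EReal, ∃ T' : Finset (EReal × EReal), z ∈ T →
      (∀ w ∈ T', Near₂ (t - s) z w) ∧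
      pointMult (e s) z.1 z.2 ≤ ∑ w ∈ T', pointMult (e t) w.1 w.2 := by
    intro z
    by_cases hz : z ∈ T
    · obtain ⟨T', h'⟩ := h.pointMult_le_sum hs hst htε (hgap z hz)
      exact ⟨T', fun _ => h'⟩
    · exact ⟨∅, fun h => absurd h hz⟩
  choose T' hT' using hex
  refine ⟨T.biUnion T', ?_, ?_⟩
  · intro w hw
    obtain ⟨z, hz, hzw⟩ := Finset.mem_biUnion.1 hw
    obtain ⟨q, hq, hqz⟩ := hT z hz
    refine ⟨q, hq, ?_⟩
    have := hqz.trans ((hT' z hz).1 w hzw)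
    rwa [add_sub_cancel] at this
  · rw [Finset.sum_biUnion]
    · exact hn.trans (Finset.sum_le_sum fun z hz => (hT' z hz).2)
    · intro z hz z' hz' hne
      rw [Function.onFun, Finset.disjoint_left]
      intro w hw hw'
      exact hsep z hz z' hz' hne
        ((((hT' z hz).1 w hw).trans ((hT' z' hz').1 w hw').symm).mono (by linarith))

/-- Mass cannot escape from the growing neighbourhoods of a finite set as long as these stay away
from the diagonal. -/
theorem BoxFlow.hasMass (h : BoxFlow ε e) (hε : 0 ≤ ε) (hA : ∀ q ∈ A, q.1 + ε < q.2 - ε)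
    (h0 : HasMass e A n 0) : HasMass e A n ε := by
  -- The left lemma shows that the supremum of `S` belongs to `S`; the right one shows that it
  -- cannot be smaller than `ε`.
  set S : Set ℝ := {s | 0 ≤ s ∧ s ≤ ε ∧ HasMass e A n s} with hS
  have hne : S.Nonempty := ⟨0, le_rfl, hε, h0⟩
  have hbdd : BddAbove S := ⟨ε, fun s hs => hs.2.1⟩
  have hσε : sSup S ≤ ε := csSup_le hne fun s hs => hs.2.1
  have hσ0 : 0 ≤ sSup S := le_csSup hbdd ⟨le_rfl, hε, h0⟩
  obtain ⟨r, hr, hleft⟩ := h.exists_hasMass_of_left (n := n) hA hσε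
  obtain ⟨t, ht, htσ⟩ := exists_lt_of_lt_csSup hne (sub_lt_self (sSup S) hr)
  have hσ : HasMass e A n (sSup S) :=
    hleft t ht.1 (le_csSup hbdd ht) (by linarith) ht.2.2
  obtain ⟨r', hr', hright⟩ := h.exists_hasMass_of_right hA hσ0 hσ
  rcases hσε.eq_or_lt with heq | hlt
  · rwa [← heq]
  · have hmin : sSup S < min ε (sSup S + r') := lt_min hlt (by linarith)
    have hmem : min ε (sSup S + r') ∈ S :=
      ⟨hσ0.trans hmin.le, min_le_left _ _, hright _ hmin.le (min_le_left _ _)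
        (by have := min_le_right ε (sSup S + r'); linarith)⟩
    exact absurd (le_csSup hbdd hmem) (not_le.2 hmin)

/-! ### The preorder indexing a pair of interleaved diagrams -/

/-- Two copies of the real line. -/
structure TwoLines (ε : ℝ≥0) where
  side : Bool
  pos : ℝ

namespace TwoLines

variable {ε : ℝ≥0}

/-- Changing lines costs `ε`. An interleaving becomes a single functor on this preorder, and its
naturality and composition laws become functoriality. -/
instance : Preorder (TwoLines ε) where
  le p q := p.pos + (if p.side = q.side then 0 else (ε : ℝ)) ≤ q.pos
  le_refl p := by simp
  le_trans p q r h h' := by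
    have := ε.2
    rcases p with ⟨_ | _, x⟩ <;> rcases q with ⟨_ | _, y⟩ <;> rcases r with ⟨_ | _, z⟩ <;>
      simp at h h' ⊢ <;> linarith

lemma le_iff {p q : TwoLines ε} :
    p ≤ q ↔ p.pos + (if p.side = q.side then 0 else (ε : ℝ)) ≤ q.pos := Iff.rfl

@[simp] lemma mk_le_mk_self {i : Bool} {x y : ℝ} :
    (⟨i, x⟩ : TwoLines ε) ≤ ⟨i, y⟩ ↔ x ≤ y := by simp [le_iff]

@[simp] lemma mk_le_mk_false_true {x y : ℝ} :
    (⟨false, x⟩ : TwoLines ε) ≤ ⟨true, y⟩ ↔ x + ε ≤ y := by simp [le_iff]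

@[simp] lemma mk_le_mk_true_false {x y : ℝ} :
    (⟨true, x⟩ : TwoLines ε) ≤ ⟨false, y⟩ ↔ x + ε ≤ y := by simp [le_iff]

end TwoLines

variable {C : Type u} [Category.{v} C]

/-- An interleaving, seen as a diagram indexed by two copies of the real line. -/
def interleavingFunctor {ε : ℝ≥0} {F G : ℝ ⥤ C} (φ : F ⟶ translation ε ⋙ G)
    (ψ : G ⟶ translation ε ⋙ F)
    (h₁ : ∀ x : ℝ, φ.app x ≫ ψ.app (x + ε) = F.map (homOfLE (le_add_add ε x)))
    (h₂ : ∀ x : ℝ, ψ.app x ≫ φ.app (x + ε) = G.map (homOfLE (le_add_add ε x))) :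
    TwoLines ε ⥤ C where
  obj p := match p with
    | ⟨false, x⟩ => F.obj x
    | ⟨true, x⟩ => G.obj x
  map {p q} h := match p, q, h with
    | ⟨false, _⟩, ⟨false, _⟩, h => F.map (homOfLE (TwoLines.mk_le_mk_self.1 (leOfHom h)))
    | ⟨true, _⟩, ⟨true, _⟩, h => G.map (homOfLE (TwoLines.mk_le_mk_self.1 (leOfHom h)))
    | ⟨false, x⟩, ⟨true, _⟩, h =>
      φ.app x ≫ G.map (homOfLE (TwoLines.mk_le_mk_false_true.1 (leOfHom h)))
    | ⟨true, x⟩, ⟨false, _⟩, h =>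
      ψ.app x ≫ F.map (homOfLE (TwoLines.mk_le_mk_true_false.1 (leOfHom h)))
  map_id p := by
    rcases p with ⟨_ | _, x⟩
    · exact F.map_id x
    · exact G.map_id x
  map_comp {p q r} h h' := by
    have nφ : ∀ {x y : ℝ} (i : x ⟶ y), F.map i ≫ φ.app y =
        φ.app x ≫ G.map ((translation ε).map i) := fun i => φ.naturality i
    have nψ : ∀ {x y : ℝ} (i : x ⟶ y), G.map i ≫ ψ.app y =
        ψ.app x ≫ F.map ((translation ε).map i) := fun i => ψ.naturality i
    -- Paths that change lines twice use the interleaving identities `h₁`, `h₂`; of the others,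
    -- those whose second arrow changes lines use naturality.
    rcases p with ⟨_ | _, x⟩ <;> rcases q with ⟨_ | _, y⟩ <;> rcases r with ⟨_ | _, z⟩ <;> dsimp only
    · rw [← F.map_comp]; rfl
    · rw [← Category.assoc, nφ, Category.assoc]
      erw [← G.map_comp]; rfl
    · rw [Category.assoc, ← Category.assoc (G.map _), nψ, Category.assoc, ← Category.assoc (φ.app x)]
      erw [h₁, ← F.map_comp, ← F.map_comp]; rfl
    · rw [Category.assoc, ← G.map_comp]; rfl
    · rw [Category.assoc, ← F.map_comp]; rfl
    · rw [Category.assoc, ← Category.assoc (F.map _), nφ, Category.assoc, ← Category.assoc (ψ.app x)]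
      erw [h₂, ← G.map_comp, ← G.map_comp]; rfl
    · rw [← Category.assoc, nψ, Category.assoc]
      erw [← F.map_comp]; rfl
    · rw [← G.map_comp]; rfl

/-- The embedding of the real line as one of the two lines. -/
def lineFunctor (ε : ℝ≥0) (i : Bool) : ℝ ⥤ TwoLines ε :=
  Monotone.functor (f := fun x => ⟨i, x⟩) fun _ _ h => TwoLines.mk_le_mk_self.2 h

/-- These are equalities of functors, not mere isomorphisms, so later proofs can replace `F` and `G`
by the two restrictions of `E`. -/
lemma Interleaved.exists_functor {ε : ℝ≥0} {F G : ℝ ⥤ C} (h : Interleaved ε F G) :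
    ∃ E : TwoLines ε ⥤ C, lineFunctor ε false ⋙ E = F ∧ lineFunctor ε true ⋙ E = G := by
  obtain ⟨φ, ψ, h₁, h₂⟩ := h
  exact ⟨interleavingFunctor φ ψ h₁ h₂, rfl, rfl⟩

/-! ### Interpolation between interleaved diagrams -/

section Interpolation

open Limits

variable [HasFiniteColimits C] {ε : ℝ≥0} (E : TwoLines ε ⥤ C)

section Obj

variable (x : ℝ) (s : Set.Icc (0 : ℝ) ε)

/-- The first leg of the span defining the interpolation. -/
noncomputable def leftLeg :
    E.obj ⟨false, x - 2 * ε + s⟩ ⨿ E.obj ⟨true, x - ε - s⟩ ⟶ E.obj ⟨false, x - s⟩ :=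
  coprod.desc (E.map (homOfLE (by have := s.2.2; simp; linarith)))
    (E.map (homOfLE (by simp; linarith)))

/-- The second leg of the span defining the interpolation. -/
noncomputable def rightLeg :
    E.obj ⟨false, x - 2 * ε + s⟩ ⨿ E.obj ⟨true, x - ε - s⟩ ⟶ E.obj ⟨true, x - ε + s⟩ :=
  coprod.desc (E.map (homOfLE (by have := s.2.2; simp; linarith)))
    (E.map (homOfLE (by have := s.2.1; simp; linarith)))

/-- The value at `x` of the interpolation at time `s`. -/
noncomputable def interpObj : C := pushout (leftLeg E x s) (rightLeg E x s)

/-- The first structure map. -/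
noncomputable def interpInl : E.obj ⟨false, x - s⟩ ⟶ interpObj E x s := pushout.inl _ _

/-- The second structure map. -/
noncomputable def interpInr : E.obj ⟨true, x - ε + s⟩ ⟶ interpObj E x s := pushout.inr _ _

variable {E x s}

lemma interp_hom_ext {Z : C} {f g : interpObj E x s ⟶ Z}
    (h₁ : interpInl E x s ≫ f = interpInl E x s ≫ g)
    (h₂ : interpInr E x s ≫ f = interpInr E x s ≫ g) : f = g :=
  pushout.hom_ext h₁ h₂

/-- The pushout square, precomposed with an arrow into either summand. The arrows `h₁`, `h₂` may be
arbitrary because parallel arrows in a preorder agree. -/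
lemma map_interpInl_eq_map_interpInr {p : TwoLines ε}
    (h : p ≤ ⟨false, x - 2 * ε + s⟩ ∨ p ≤ ⟨true, x - ε - s⟩)
    (h₁ : p ⟶ ⟨false, x - s⟩) (h₂ : p ⟶ ⟨true, x - ε + s⟩) :
    E.map h₁ ≫ interpInl E x s = E.map h₂ ≫ interpInr E x s := by
  have hc : leftLeg E x s ≫ interpInl E x s = rightLeg E x s ≫ interpInr E x s :=
    pushout.condition
  rcases h with h | h
  · have := coprod.inl ≫= hc
    simp only [leftLeg, rightLeg, coprod.inl_desc_assoc] at this
    have := E.map (homOfLE h) ≫= this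
    rwa [← Category.assoc, ← Category.assoc, ← E.map_comp, ← E.map_comp] at this
  · have := coprod.inr ≫= hc
    simp only [leftLeg, rightLeg, coprod.inr_desc_assoc] at this
    have := E.map (homOfLE h) ≫= this
    rwa [← Category.assoc, ← Category.assoc, ← E.map_comp, ← E.map_comp] at this

/-- A cocone under the two defining objects factors through the interpolation. -/
lemma exists_interp_desc {Z : C} (f : E.obj ⟨false, x - s⟩ ⟶ Z)
    (g : E.obj ⟨true, x - ε + s⟩ ⟶ Z)
    (h₁ : ∀ (i : (⟨false, x - 2 * ε + s⟩ : TwoLines ε) ⟶ ⟨false, x - s⟩)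
      (j : (⟨false, x - 2 * ε + s⟩ : TwoLines ε) ⟶ ⟨true, x - ε + s⟩),
        E.map i ≫ f = E.map j ≫ g)
    (h₂ : ∀ (i : (⟨true, x - ε - s⟩ : TwoLines ε) ⟶ ⟨false, x - s⟩)
      (j : (⟨true, x - ε - s⟩ : TwoLines ε) ⟶ ⟨true, x - ε + s⟩),
        E.map i ≫ f = E.map j ≫ g) :
    ∃ k : interpObj E x s ⟶ Z, interpInl E x s ≫ k = f ∧ interpInr E x s ≫ k = g := by
  have hc : leftLeg E x s ≫ f = rightLeg E x s ≫ g := by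
    apply coprod.hom_ext
    · simp only [leftLeg, rightLeg, coprod.inl_desc_assoc]
      exact h₁ _ _
    · simp only [leftLeg, rightLeg, coprod.inr_desc_assoc]
      exact h₂ _ _
  exact ⟨pushout.desc f g hc, pushout.inl_desc _ _ _, pushout.inr_desc _ _ _⟩

end Obj

/-- The condition on `|s - t|` says exactly that both legs at `(x, s)` lie below the corresponding
legs at `(y, t)`. Taking `s = t` gives structure maps of one diagram, taking `s ≠ t` gives
interleaving maps between two. -/
lemma exists_interpMap {x y : ℝ} {s t : Set.Icc (0 : ℝ) ε} (h : |(s : ℝ) - t| ≤ y - x) :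
    ∃ k : interpObj E x s ⟶ interpObj E y t,
      (∀ i, interpInl E x s ≫ k = E.map i ≫ interpInl E y t) ∧
      (∀ i, interpInr E x s ≫ k = E.map i ≫ interpInr E y t) := by
  obtain ⟨h1, h2⟩ := abs_le.1 h
  have i₁ : (⟨false, x - s⟩ : TwoLines ε) ≤ ⟨false, y - t⟩ := by simp; linarith
  have i₂ : (⟨true, x - ε + s⟩ : TwoLines ε) ≤ ⟨true, y - ε + t⟩ := by simp; linarith
  obtain ⟨k, hk₁, hk₂⟩ := exists_interp_desc (E.map (homOfLE i₁) ≫ interpInl E y t)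
    (E.map (homOfLE i₂) ≫ interpInr E y t)
    (fun i j => by
      rw [← Category.assoc, ← Category.assoc, ← E.map_comp, ← E.map_comp]
      exact map_interpInl_eq_map_interpInr (Or.inl (by simp; linarith)) _ _)
    (fun i j => by
      rw [← Category.assoc, ← Category.assoc, ← E.map_comp, ← E.map_comp]
      exact map_interpInl_eq_map_interpInr (Or.inr (by simp; linarith)) _ _)
  exact ⟨k, fun _ => hk₁, fun _ => hk₂⟩

/-- The structure maps of the interpolation. -/
noncomputable def interpMap {x y : ℝ} {s t : Set.Icc (0 : ℝ) ε} (h : |(s : ℝ) - t| ≤ y - x) :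
    interpObj E x s ⟶ interpObj E y t :=
  (exists_interpMap E h).choose

lemma inl_interpMap {x y : ℝ} {s t : Set.Icc (0 : ℝ) ε} (h : |(s : ℝ) - t| ≤ y - x)
    (i : (⟨false, x - s⟩ : TwoLines ε) ⟶ ⟨false, y - t⟩) :
    interpInl E x s ≫ interpMap E h = E.map i ≫ interpInl E y t :=
  (exists_interpMap E h).choose_spec.1 i

lemma inr_interpMap {x y : ℝ} {s t : Set.Icc (0 : ℝ) ε} (h : |(s : ℝ) - t| ≤ y - x)
    (i : (⟨true, x - ε + s⟩ : TwoLines ε) ⟶ ⟨true, y - ε + t⟩) :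
    interpInr E x s ≫ interpMap E h = E.map i ≫ interpInr E y t :=
  (exists_interpMap E h).choose_spec.2 i

lemma interpMap_comp {x y z : ℝ} {r s t : Set.Icc (0 : ℝ) ε} (h : |(r : ℝ) - s| ≤ y - x)
    (h' : |(s : ℝ) - t| ≤ z - y) (h'' : |(r : ℝ) - t| ≤ z - x) :
    interpMap E h ≫ interpMap E h' = interpMap E h'' := by
  obtain ⟨a1, a2⟩ := abs_le.1 h
  obtain ⟨b1, b2⟩ := abs_le.1 h'
  have i₁ : (⟨false, x - r⟩ : TwoLines ε) ≤ ⟨false, y - s⟩ := by simp; linarith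
  have i₂ : (⟨true, x - ε + r⟩ : TwoLines ε) ≤ ⟨true, y - ε + s⟩ := by simp; linarith
  have j₁ : (⟨false, y - s⟩ : TwoLines ε) ≤ ⟨false, z - t⟩ := by simp; linarith
  have j₂ : (⟨true, y - ε + s⟩ : TwoLines ε) ≤ ⟨true, z - ε + t⟩ := by simp; linarith
  apply interp_hom_ext
  · rw [← Category.assoc, inl_interpMap E h (homOfLE i₁), Category.assoc,
      inl_interpMap E h' (homOfLE j₁), ← Category.assoc, ← E.map_comp, inl_interpMap]
  · rw [← Category.assoc, inr_interpMap E h (homOfLE i₂), Category.assoc,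
      inr_interpMap E h' (homOfLE j₂), ← Category.assoc, ← E.map_comp, inr_interpMap]

lemma interpMap_comp_eq {x y y' z : ℝ} {r s s' t : Set.Icc (0 : ℝ) ε}
    (h₁ : |(r : ℝ) - s| ≤ y - x) (h₂ : |(s : ℝ) - t| ≤ z - y)
    (h₁' : |(r : ℝ) - s'| ≤ y' - x) (h₂' : |(s' : ℝ) - t| ≤ z - y') :
    interpMap E h₁ ≫ interpMap E h₂ = interpMap E h₁' ≫ interpMap E h₂' := by
  have h : |(r : ℝ) - t| ≤ z - x := by
    have := abs_sub_le (r : ℝ) s t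
    linarith
  rw [interpMap_comp E h₁ h₂ h, interpMap_comp E h₁' h₂' h]

lemma interpMap_self {x : ℝ} {s : Set.Icc (0 : ℝ) ε} (h : |(s : ℝ) - s| ≤ x - x) :
    interpMap E h = 𝟙 (interpObj E x s) := by
  apply interp_hom_ext
  · rw [inl_interpMap E h (𝟙 _), E.map_id, Category.id_comp, Category.comp_id]
  · rw [inr_interpMap E h (𝟙 _), E.map_id, Category.id_comp, Category.comp_id]

/-- The interpolation at time `s`. -/
noncomputable def interp (s : Set.Icc (0 : ℝ) ε) : ℝ ⥤ C where
  obj x := interpObj E x s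
  map {x y} h := interpMap E (by simpa using leOfHom h)
  map_id x := interpMap_self E _
  map_comp f g := (interpMap_comp E _ _ _).symm

/-- Both families consist of maps `interpMap` across times, so every required identity is an
instance of `interpMap_comp`. -/
lemma interleaved_interp (s t : Set.Icc (0 : ℝ) ε) (δ : ℝ≥0) (h : |(s : ℝ) - t| ≤ δ) :
    Interleaved δ (interp E s) (interp E t) := by
  have h' : |(t : ℝ) - s| ≤ δ := by rwa [abs_sub_comm]
  refine ⟨⟨fun x => interpMap E (s := s) (t := t) (y := x + δ) (by simpa using h), ?_⟩,
    ⟨fun x => interpMap E (s := t) (t := s) (y := x + δ) (by simpa using h'), ?_⟩, ?_, ?_⟩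
  · intro x y f
    exact interpMap_comp_eq E (by simpa using leOfHom f) (by simpa using h) _ (by simpa [translation] using leOfHom f)
  · intro x y f
    exact interpMap_comp_eq E (by simpa using leOfHom f) (by simpa using h') _ (by simpa [translation] using leOfHom f)
  · intro x
    exact interpMap_comp E (by simpa using h) (by simpa using h')
      (by rw [sub_self, abs_zero]; exact sub_nonneg.2 (le_add_add δ x))
  · intro x
    exact interpMap_comp E (by simpa using h') (by simpa using h)
      (by rw [sub_self, abs_zero]; exact sub_nonneg.2 (le_add_add δ x))

/-- Common core of the two endpoint identifications. The map to the line comes from the universal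
property and is natural; `l` is its pointwise inverse. Since that map is built inside the proof,
`hl` is assumed for every map with the right legs. -/
lemma nonempty_interp_iso_line (i : Bool) (s : Set.Icc (0 : ℝ) ε)
    (h₁ : ∀ x, (⟨false, x - s⟩ : TwoLines ε) ≤ ⟨i, x⟩)
    (h₂ : ∀ x, (⟨true, x - ε + s⟩ : TwoLines ε) ≤ ⟨i, x⟩)
    (l : ∀ x, E.obj ⟨i, x⟩ ⟶ interpObj E x s)
    (hl₁ : ∀ x, E.map (homOfLE (h₁ x)) ≫ l x = interpInl E x s)
    (hl₂ : ∀ x, E.map (homOfLE (h₂ x)) ≫ l x = interpInr E x s)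
    (hl : ∀ x (k : interpObj E x s ⟶ E.obj ⟨i, x⟩), interpInl E x s ≫ k = E.map (homOfLE (h₁ x)) →
      interpInr E x s ≫ k = E.map (homOfLE (h₂ x)) → l x ≫ k = 𝟙 _) :
    Nonempty (interp E s ≅ lineFunctor ε i ⋙ E) := by
  have key : ∀ x : ℝ, ∃ k : interpObj E x s ⟶ E.obj ⟨i, x⟩,
      interpInl E x s ≫ k = E.map (homOfLE (h₁ x)) ∧
      interpInr E x s ≫ k = E.map (homOfLE (h₂ x)) := fun x =>
    exists_interp_desc (E.map (homOfLE (h₁ x))) (E.map (homOfLE (h₂ x)))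
      (fun i j => by rw [← E.map_comp, ← E.map_comp]; rfl)
      (fun i j => by rw [← E.map_comp, ← E.map_comp]; rfl)
  choose k hk₁ hk₂ using key
  have hkl : ∀ x, k x ≫ l x = 𝟙 (interpObj E x s) := by
    intro x
    apply interp_hom_ext
    · rw [← Category.assoc, hk₁, hl₁, Category.comp_id]
    · rw [← Category.assoc, hk₂, hl₂, Category.comp_id]
  have hnat : ∀ x y (h : |(s : ℝ) - s| ≤ y - x)
      (f : (⟨i, x⟩ : TwoLines ε) ⟶ ⟨i, y⟩), interpMap E h ≫ k y = k x ≫ E.map f := by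
    intro x y h f
    have hxy : x ≤ y := by simpa using h
    apply interp_hom_ext
    · rw [← Category.assoc, ← Category.assoc, inl_interpMap E h (homOfLE (by simpa using hxy)),
        Category.assoc, hk₁, hk₁, ← E.map_comp, ← E.map_comp]
      rfl
    · rw [← Category.assoc, ← Category.assoc, inr_interpMap E h (homOfLE (by simpa using hxy)),
        Category.assoc, hk₂, hk₂, ← E.map_comp, ← E.map_comp]
      rfl
  exact ⟨NatIso.ofComponents (fun x => ⟨k x, l x, hkl x, hl x _ (hk₁ x) (hk₂ x)⟩)
    fun f => hnat _ _ (by simpa using leOfHom f) _⟩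

/-- The interpolation starts at the first diagram. -/
lemma nonempty_interp_zero_iso (s : Set.Icc (0 : ℝ) ε) (hs : (s : ℝ) = 0) :
    Nonempty (interp E s ≅ lineFunctor ε false ⋙ E) := by
  have j : ∀ x : ℝ, (⟨false, x⟩ : TwoLines ε) ≤ ⟨false, x - s⟩ := fun x => by simp [hs]
  refine nonempty_interp_iso_line E false s (fun x => by simp [hs]) (fun x => by simp [hs])
    (fun x => E.map (homOfLE (j x)) ≫ interpInl E x s) ?_ ?_ ?_
  · intro x
    rw [← Category.assoc, ← E.map_comp]
    conv_rhs => rw [← Category.id_comp (interpInl E x s), ← E.map_id]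
    rfl
  · intro x
    rw [← Category.assoc, ← E.map_comp]
    conv_rhs => rw [← Category.id_comp (interpInr E x s), ← E.map_id]
    -- At `s = 0` the glued object `G(x - ε - s)` is all of the second leg, so the pushout adds
    -- nothing to `F(x)`.
    exact map_interpInl_eq_map_interpInr (Or.inr (by simp [hs])) _ _
  · intro x k hk _
    rw [Category.assoc, hk, ← E.map_comp]
    exact E.map_id _

/-- The interpolation ends at the second diagram. -/
lemma nonempty_interp_end_iso (s : Set.Icc (0 : ℝ) ε) (hs : (s : ℝ) = ε) :
    Nonempty (interp E s ≅ lineFunctor ε true ⋙ E) := by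
  have j : ∀ x : ℝ, (⟨true, x⟩ : TwoLines ε) ≤ ⟨true, x - ε + s⟩ := fun x => by simp [hs]
  refine nonempty_interp_iso_line E true s (fun x => by simp [hs]) (fun x => by simp [hs])
    (fun x => E.map (homOfLE (j x)) ≫ interpInr E x s) ?_ ?_ ?_
  · intro x
    rw [← Category.assoc, ← E.map_comp]
    conv_rhs => rw [← Category.id_comp (interpInl E x s), ← E.map_id]
    exact (map_interpInl_eq_map_interpInr (Or.inl (by simp [hs]; linarith)) _ _).symm
  · intro x
    rw [← Category.assoc, ← E.map_comp]
    conv_rhs => rw [← Category.id_comp (interpInr E x s), ← E.map_id]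
    rfl
  · intro x k _ hk
    rw [Category.assoc, hk, ← E.map_comp]
    exact E.map_id _

end Interpolation

/-! ### The persistence function of a diagram indexed by a preorder -/

section Preorder

variable {J : Type*} [Preorder J] (p : CatPersistenceFunction C) (E : J ⥤ C)

/-- The persistence function induced by a diagram indexed by a preorder. -/
def pOn {a b : J} (h : a ≤ b) : ℤ := p.toFun (E.map (homOfLE h))

lemma pOn_le_of_le_left {a b c : J} (h : a ≤ b) (h' : b ≤ c) :
    pOn p E (h.trans h') ≤ pOn p E h' := by
  have := p.precomp_le (E.map (homOfLE h)) (E.map (homOfLE h'))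
  rwa [← E.map_comp] at this

lemma pOn_le_of_le_right {a b c : J} (h : a ≤ b) (h' : b ≤ c) :
    pOn p E (h.trans h') ≤ pOn p E h := by
  have := p.postcomp_le (E.map (homOfLE h)) (E.map (homOfLE h'))
  rwa [← E.map_comp] at this

lemma pOn_jump {a b c d : J} (h₁ : a ≤ b) (h₂ : b ≤ c) (h₃ : c ≤ d) :
    pOn p E (h₂.trans h₃) - pOn p E (h₁.trans (h₂.trans h₃)) ≤
      pOn p E h₂ - pOn p E (h₁.trans h₂) := by
  have := p.jump_le (E.map (homOfLE h₁)) (E.map (homOfLE h₂)) (E.map (homOfLE h₃))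
  rwa [← E.map_comp, ← E.map_comp, ← E.map_comp] at this

/-- The outer box, with corners from `a₀, a₃, a₄, a₇`, minus the inner one, with corners from `a₁,
a₂, a₅, a₆`, is tiled by four boxes, each nonnegative by `pOn_jump`. It is applied to a chain in
`TwoLines` whose outer corners lie on one line and inner corners on the other. -/
lemma pOn_box_le {a₀ a₁ a₂ a₃ a₄ a₅ a₆ a₇ : J} (h₁ : a₀ ≤ a₁) (h₂ : a₁ ≤ a₂) (h₃ : a₂ ≤ a₃)
    (h₄ : a₃ ≤ a₄) (h₅ : a₄ ≤ a₅) (h₆ : a₅ ≤ a₆) (h₇ : a₆ ≤ a₇) :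
    pOn p E (h₃.trans (h₄.trans h₅)) - pOn p E (h₂.trans (h₃.trans (h₄.trans h₅))) -
        pOn p E (h₃.trans (h₄.trans (h₅.trans h₆))) +
        pOn p E (h₂.trans (h₃.trans (h₄.trans (h₅.trans h₆)))) ≤
      pOn p E h₄ - pOn p E (h₁.trans (h₂.trans (h₃.trans h₄))) -
        pOn p E (h₄.trans (h₅.trans (h₆.trans h₇))) +
        pOn p E (h₁.trans (h₂.trans (h₃.trans (h₄.trans (h₅.trans (h₆.trans h₇)))))) := by
  have e₁ := pOn_jump p E h₁ (h₂.trans (h₃.trans h₄)) (h₅.trans (h₆.trans h₇))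
  have e₂ := pOn_jump p E h₃ h₄ (h₅.trans (h₆.trans h₇))
  have e₃ := pOn_jump p E h₂ (h₃.trans h₄) h₅
  have e₄ := pOn_jump p E h₂ (h₃.trans (h₄.trans (h₅.trans h₆))) h₇
  linarith

/-- The form of `pOn_box_le` for boxes with left side at `⊥`: the two corners there both contribute
the minimum and cancel. -/
lemma pOn_box_le_of_bot {a₂ a₃ a₄ a₅ a₆ a₇ : J} (h₃ : a₂ ≤ a₃)
    (h₄ : a₃ ≤ a₄) (h₅ : a₄ ≤ a₅) (h₆ : a₅ ≤ a₆) (h₇ : a₆ ≤ a₇) :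
    pOn p E (h₃.trans (h₄.trans h₅)) - pOn p E (h₃.trans (h₄.trans (h₅.trans h₆))) ≤
      pOn p E h₄ - pOn p E (h₄.trans (h₅.trans (h₆.trans h₇))) := by
  have e₁ := pOn_jump p E h₃ (h₄.trans h₅) h₆
  have e₂ := pOn_le_of_le_right p E h₄ h₅
  have e₃ := pOn_le_of_le_right p E (h₄.trans (h₅.trans h₆)) h₇
  linarith

lemma pOn_box_le_of_top {a₀ a₁ a₂ a₃ a₄ a₅ : J} (h₁ : a₀ ≤ a₁) (h₂ : a₁ ≤ a₂) (h₃ : a₂ ≤ a₃)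
    (h₄ : a₃ ≤ a₄) (h₅ : a₄ ≤ a₅) :
    pOn p E (h₃.trans (h₄.trans h₅)) - pOn p E (h₂.trans (h₃.trans (h₄.trans h₅))) ≤
      pOn p E h₄ - pOn p E (h₁.trans (h₂.trans (h₃.trans h₄))) := by
  have e₁ := pOn_jump p E h₂ (h₃.trans h₄) h₅
  have e₂ := pOn_le_of_le_left p E h₃ h₄
  have e₃ := pOn_le_of_le_left p E h₁ (h₂.trans (h₃.trans h₄))
  linarith

lemma pOn_le_of_le_of_le {a b c d : J} (h₁ : a ≤ b) (h₂ : b ≤ c) (h₃ : c ≤ d) :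
    pOn p E (h₁.trans (h₂.trans h₃)) ≤ pOn p E h₂ :=
  (pOn_le_of_le_left p E h₁ (h₂.trans h₃)).trans (pOn_le_of_le_right p E h₂ h₃)

end Preorder

/-! ### The extended persistence function -/

variable {p : CatPersistenceFunction C} {F G : ℝ ⥤ C}

lemma pMin_le (p : CatPersistenceFunction C) (F : ℝ ⥤ C) {x y : ℝ} (h : x ≤ y) :
    pMin p F ≤ pF p F h := by
  obtain ⟨m, hm⟩ := p.lower_bounded
  refine csInf_le ⟨m, ?_⟩ ⟨x, y, h, rfl⟩
  rintro n ⟨x, y, h, rfl⟩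
  exact hm _

lemma le_pMin {n : ℤ} (h : ∀ (x y : ℝ) (h : x ≤ y), n ≤ pF p F h) : n ≤ pMin p F := by
  refine le_csInf ⟨_, 0, 0, le_rfl, rfl⟩ ?_
  rintro _ ⟨x, y, h', rfl⟩
  exact h x y h'

lemma pExt_coe {x y : ℝ} (h : x ≤ y) : pExt p F (x : EReal) (y : EReal) = pF p F h := by
  rw [pExt, dif_pos ⟨EReal.coe_le_coe_iff.2 h, EReal.coe_ne_bot _, EReal.coe_ne_top _⟩]
  rfl

lemma pExt_bot (v : EReal) : pExt p F ⊥ v = pMin p F := by simp [pExt]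

lemma pExt_top (u : EReal) : pExt p F u ⊤ = pMin p F := by simp [pExt]

/-- For a finite box this is the jump inequality. With one infinite side two corners cancel and
monotonicity remains; with two, minimality of `pMin`. Once degenerate boxes are set aside, `b` and
`c` are finite. -/
lemma boxNonneg_pExt (p : CatPersistenceFunction C) (F : ℝ ⥤ C) : BoxNonneg (pExt p F) := by
  intro a b c d hab hbc hcd
  rcases hab.eq_or_lt with rfl | hab
  · simp [box]
  rcases hcd.eq_or_lt with rfl | hcd
  · simp [box]
  lift b to ℝ using ⟨((hbc.trans_lt hcd).trans_le le_top).ne, (bot_le.trans_lt hab).ne'⟩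
  lift c to ℝ using ⟨(hcd.trans_le le_top).ne, ((EReal.bot_lt_coe b).trans_le hbc).ne'⟩
  have hbc : b ≤ c := EReal.coe_le_coe_iff.1 hbc
  induction a using EReal.rec with
  | top => exact absurd hab not_top_lt
  | bot =>
    induction d using EReal.rec with
    | bot => exact absurd hcd not_lt_bot
    | top => simp only [box, pExt_bot, pExt_top, pExt_coe hbc]; linarith [pMin_le p F hbc]
    | coe d =>
      have hcd : c ≤ d := (EReal.coe_lt_coe_iff.1 hcd).le
      simp only [box, pExt_bot, pExt_coe hbc, pExt_coe (hbc.trans hcd)]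
      have := pOn_le_of_le_right p F hbc hcd
      unfold pOn at this
      unfold pF
      linarith
  | coe a =>
    have hab : a ≤ b := (EReal.coe_lt_coe_iff.1 hab).le
    induction d using EReal.rec with
    | bot => exact absurd hcd not_lt_bot
    | top =>
      simp only [box, pExt_top, pExt_coe hbc, pExt_coe (hab.trans hbc)]
      have := pOn_le_of_le_left p F hab hbc
      unfold pOn at this
      unfold pF
      linarith
    | coe d =>
      have hcd : c ≤ d := (EReal.coe_lt_coe_iff.1 hcd).le
      simp only [box, pExt_coe hbc, pExt_coe (hab.trans hbc), pExt_coe (hbc.trans hcd),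
        pExt_coe (hab.trans (hbc.trans hcd))]
      have := pOn_jump p F hab hbc hcd
      unfold pOn at this
      unfold pF
      linarith

/-! ### Interleavings and isomorphisms acting on the extended persistence function -/

lemma Interleaved.symm {δ : ℝ≥0} (h : Interleaved δ F G) : Interleaved δ G F := by
  obtain ⟨φ, ψ, h₁, h₂⟩ := h
  exact ⟨ψ, φ, h₂, h₁⟩

/-- The map `G(x - δ ≤ y + δ)` factors through `F(x ≤ y)`, and factoring can only lower `p`.
Equality of the minima is what the box inequality needs at infinite corners. -/
lemma Interleaved.pMin_le {δ : ℝ≥0} (h : Interleaved δ F G) : pMin p G ≤ pMin p F := by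
  obtain ⟨E, rfl, rfl⟩ := h.exists_functor
  refine le_pMin fun x y hxy => ?_
  have hδ := δ.2
  have h₁ : (⟨true, x - δ⟩ : TwoLines δ) ≤ ⟨false, x⟩ := by simp
  have h₂ : (⟨false, x⟩ : TwoLines δ) ≤ ⟨false, y⟩ := by simpa using hxy
  have h₃ : (⟨false, y⟩ : TwoLines δ) ≤ ⟨true, y + δ⟩ := by simp
  exact (Persistence.pMin_le p _ (show x - δ ≤ y + δ by linarith)).trans
    (pOn_le_of_le_of_le p E h₁ h₂ h₃)

lemma Interleaved.pMin_eq {δ : ℝ≥0} (h : Interleaved δ F G) : pMin p F = pMin p G :=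
  le_antisymm h.symm.pMin_le h.pMin_le

/-- The box inequality for interleaved diagrams. -/
lemma Interleaved.box_le {δ : ℝ≥0} (h : Interleaved δ F G) {a b c d : EReal} (hab : a ≤ b)
    (hcd : c ≤ d) (hbc : b + (δ : ℝ) ≤ c - (δ : ℝ)) :
    box (pExt p F) a b c d ≤
      box (pExt p G) (a - (δ : ℝ)) (b + (δ : ℝ)) (c - (δ : ℝ)) (d + (δ : ℝ)) := by
  have hδ : (0 : ℝ) ≤ δ := δ.2
  have hδ' : (0 : EReal) ≤ (δ : ℝ) := by exact_mod_cast hδ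
  have hsub : ∀ x : EReal, x - (δ : ℝ) ≤ x := fun x =>
    EReal.sub_le_of_le_add (le_add_of_nonneg_right hδ')
  have hadd : ∀ x : EReal, x ≤ x + (δ : ℝ) := fun x => le_add_of_nonneg_right hδ'
  have hnn := boxNonneg_pExt p G ((hsub a).trans (hab.trans (hadd b))) hbc
    ((hsub c).trans (hcd.trans (hadd d)))
  rcases hab.eq_or_lt with rfl | hab
  · refine le_trans (le_of_eq ?_) hnn
    simp [box]
  rcases hcd.eq_or_lt with rfl | hcd
  · refine le_trans (le_of_eq ?_) hnn
    simp [box]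
  have hbc' : b ≤ c := (hadd b).trans (hbc.trans (hsub c))
  lift b to ℝ using ⟨((hbc'.trans_lt hcd).trans_le le_top).ne, (bot_le.trans_lt hab).ne'⟩
  lift c to ℝ using ⟨(hcd.trans_le le_top).ne, ((EReal.bot_lt_coe b).trans_le hbc').ne'⟩
  have hm : pMin p F = pMin p G := h.pMin_eq
  have hbcδ : b + δ ≤ c - δ := by exact_mod_cast hbc
  have hbc : b ≤ c := EReal.coe_le_coe_iff.1 hbc'
  obtain ⟨E, rfl, rfl⟩ := h.exists_functor
  have h₃ : (⟨false, b⟩ : TwoLines δ) ≤ ⟨true, b + δ⟩ := by simp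
  have h₄ : (⟨true, b + δ⟩ : TwoLines δ) ≤ ⟨true, c - δ⟩ := by simpa using hbcδ
  have h₅ : (⟨true, c - δ⟩ : TwoLines δ) ≤ ⟨false, c⟩ := by simp
  rw [← EReal.coe_add, ← EReal.coe_sub]
  induction a using EReal.rec with
  | top => exact absurd hab not_top_lt
  | bot =>
    induction d using EReal.rec with
    | bot => exact absurd hcd not_lt_bot
    | top =>
      simp only [box, EReal.bot_sub, EReal.top_add_coe, pExt_bot, pExt_top, pExt_coe hbc,
        pExt_coe hbcδ]
      have : pF p (lineFunctor δ false ⋙ E) hbc ≤ pF p (lineFunctor δ true ⋙ E) hbcδ :=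
        pOn_le_of_le_of_le p E h₃ h₄ h₅
      linarith
    | coe d =>
      have hcd : c ≤ d := (EReal.coe_lt_coe_iff.1 hcd).le
      have hbdδ : b + δ ≤ d + δ := by linarith
      have h₆ : (⟨false, c⟩ : TwoLines δ) ≤ ⟨false, d⟩ := by simpa using hcd
      have h₇ : (⟨false, d⟩ : TwoLines δ) ≤ ⟨true, d + δ⟩ := by simp
      rw [← EReal.coe_add]
      simp only [box, EReal.bot_sub, pExt_bot, pExt_coe hbc, pExt_coe hbcδ,
        pExt_coe (hbc.trans hcd), pExt_coe hbdδ]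
      have : pF p (lineFunctor δ false ⋙ E) hbc - pF p (lineFunctor δ false ⋙ E) (hbc.trans hcd) ≤
          pF p (lineFunctor δ true ⋙ E) hbcδ - pF p (lineFunctor δ true ⋙ E) hbdδ :=
        pOn_box_le_of_bot p E h₃ h₄ h₅ h₆ h₇
      linarith
  | coe a =>
    have hab : a ≤ b := (EReal.coe_lt_coe_iff.1 hab).le
    have hacδ : a - δ ≤ c - δ := by linarith
    have h₁ : (⟨true, a - δ⟩ : TwoLines δ) ≤ ⟨false, a⟩ := by simp
    have h₂ : (⟨false, a⟩ : TwoLines δ) ≤ ⟨false, b⟩ := by simpa using hab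
    rw [← EReal.coe_sub]
    induction d using EReal.rec with
    | bot => exact absurd hcd not_lt_bot
    | top =>
      simp only [box, EReal.top_add_coe, pExt_top, pExt_coe hbc, pExt_coe hbcδ,
        pExt_coe (hab.trans hbc), pExt_coe hacδ]
      have : pF p (lineFunctor δ false ⋙ E) hbc - pF p (lineFunctor δ false ⋙ E) (hab.trans hbc) ≤
          pF p (lineFunctor δ true ⋙ E) hbcδ - pF p (lineFunctor δ true ⋙ E) hacδ :=
        pOn_box_le_of_top p E h₁ h₂ h₃ h₄ h₅
      linarith
    | coe d =>
      have hcd : c ≤ d := (EReal.coe_lt_coe_iff.1 hcd).le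
      have hbdδ : b + δ ≤ d + δ := by linarith
      have hadδ : a - δ ≤ d + δ := by linarith
      have h₆ : (⟨false, c⟩ : TwoLines δ) ≤ ⟨false, d⟩ := by simpa using hcd
      have h₇ : (⟨false, d⟩ : TwoLines δ) ≤ ⟨true, d + δ⟩ := by simp
      rw [← EReal.coe_add]
      simp only [box, pExt_coe hbc, pExt_coe hbcδ, pExt_coe (hab.trans hbc), pExt_coe hacδ,
        pExt_coe (hbc.trans hcd), pExt_coe hbdδ, pExt_coe (hab.trans (hbc.trans hcd)),
        pExt_coe hadδ]
      exact pOn_box_le p E h₁ h₂ h₃ h₄ h₅ h₆ h₇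

/-- The two maps are conjugate, and composition on either side can only lower `p`. -/
lemma pF_le_of_iso (i : F ≅ G) {x y : ℝ} (h : x ≤ y) : pF p F h ≤ pF p G h := by
  have : F.map (homOfLE h) = i.hom.app x ≫ G.map (homOfLE h) ≫ i.inv.app y := by
    rw [← Category.assoc, ← i.hom.naturality, Category.assoc, i.hom_inv_id_app]
    exact (Category.comp_id _).symm
  unfold pF
  rw [this]
  exact (p.precomp_le _ _).trans (p.postcomp_le _ _)

lemma pF_eq_of_iso (i : F ≅ G) {x y : ℝ} (h : x ≤ y) : pF p F h = pF p G h :=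
  le_antisymm (pF_le_of_iso i h) (pF_le_of_iso i.symm h)

lemma pExt_eq_of_iso (i : F ≅ G) : pExt p F = pExt p G := by
  have hm : pMin p F = pMin p G := by
    refine le_antisymm (le_pMin fun x y h => ?_) (le_pMin fun x y h => ?_)
    · rw [← pF_eq_of_iso i]; exact pMin_le p F h
    · rw [pF_eq_of_iso i]; exact pMin_le p G h
  funext u v
  unfold pExt
  split_ifs with h
  · exact pF_eq_of_iso i _
  · exact hm

/-- The multiplicity of a cornerpoint, in terms of boxes. -/
lemma cornerMultiplicity_eq_pointMult {u v : EReal} (huv : u < v) :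
    cornerMultiplicity p F u v = pointMult (pExt p F) u v := by
  unfold cornerMultiplicity pointMult
  congr 1
  ext n
  constructor
  · rintro ⟨I, J, hI, hJ, hIc, hJc, hIJ, rfl⟩
    have huI := mem_of_mem_nhds hI
    have hvJ := mem_of_mem_nhds hJ
    refine ⟨sInf I, sSup I, sInf J, sSup J,
      lowerNhd_of_mem (Filter.mem_of_superset hI fun x hx => sInf_le hx),
      upperNhd_of_mem (Filter.mem_of_superset hI fun x hx => le_sSup hx),
      lowerNhd_of_mem (Filter.mem_of_superset hJ fun x hx => sInf_le hx),
      upperNhd_of_mem (Filter.mem_of_superset hJ fun x hx => le_sSup hx), ?_, rfl⟩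
    have hIo := hIc.isPreconnected.ordConnected
    have hJo := hJc.isPreconnected.ordConnected
    -- If some `y ∈ J` were below some `x ∈ I`, order-connectedness would put `v` in `I` or `x` in
    -- `J`, against disjointness.
    refine sSup_le fun x hx => le_sInf fun y hy => ?_
    by_contra! hyx
    rcases le_or_gt v x with hvx | hxv
    · exact Set.disjoint_left.1 hIJ (hIo.out huI hx ⟨huv.le, hvx⟩) hvJ
    · exact Set.disjoint_left.1 hIJ hx (hJo.out hy hvJ ⟨hyx.le, hxv.le⟩)
  · rintro ⟨a, b, c, d, ha, hb, hc, hd, hbc, rfl⟩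
    have hub : u < b := by
      rcases hb with hb | rfl
      · exact hb
      · exact huv.trans_le le_top
    have hab : a < b := ha.le.trans_lt hub
    have hcd : c ≤ d := hc.le.trans hd.le
    -- The first interval is half-open so that the two stay disjoint when `b = c`.
    refine ⟨Set.Ico a b, Set.Icc c d, Filter.inter_mem ha.Ici_mem (Iio_mem_nhds hub),
      Icc_mem_nhds_of hc hd, ⟨⟨a, le_rfl, hab⟩, isPreconnected_Ico⟩,
      ⟨⟨c, le_rfl, hcd⟩, isPreconnected_Icc⟩, ?_, ?_⟩
    · exact Set.disjoint_left.2 fun x hx hx' => absurd (hx.2.trans_le (hbc.trans hx'.1)) (lt_irrefl _)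
    · rw [boxSum, csSup_Ico hab, csInf_Ico hab, csSup_Icc hcd, csInf_Icc hcd, box]

/-- Interleaved diagrams are joined by a family satisfying the box inequality. -/
lemma Interleaved.exists_boxFlow [Limits.HasFiniteColimits C] {ε : ℝ≥0} (h : Interleaved ε F G) :
    ∃ e : ℝ → EReal → EReal → ℤ, BoxFlow ε e ∧ e 0 = pExt p F ∧ e ε = pExt p G := by
  have hε : (0 : ℝ) ≤ ε := ε.2
  obtain ⟨E, rfl, rfl⟩ := h.exists_functor
  -- Projecting to `[0, ε]` only makes the family total; times outside are never used.
  refine ⟨fun s => pExt p (interp E (Set.projIcc (0 : ℝ) ε hε s)), ⟨fun s _ _ => boxNonneg_pExt _ _, ?_⟩,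
    ?_, ?_⟩
  · intro s t hs hst htε a b c d hab hcd hbc
    have h := interleaved_interp E (Set.projIcc (0 : ℝ) ε hε s) (Set.projIcc (0 : ℝ) ε hε t)
      ⟨t - s, sub_nonneg.2 hst⟩ (by
        rw [Set.projIcc_of_mem hε ⟨hs, hst.trans htε⟩, Set.projIcc_of_mem hε ⟨hs.trans hst, htε⟩,
          abs_sub_comm]
        exact (abs_of_nonneg (sub_nonneg.2 hst)).le)
    exact h.box_le hab hcd hbc
  · obtain ⟨i⟩ := nonempty_interp_zero_iso E (Set.projIcc (0 : ℝ) ε hε 0)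
      (by rw [Set.projIcc_of_mem hε ⟨le_rfl, hε⟩])
    exact pExt_eq_of_iso i
  · obtain ⟨i⟩ := nonempty_interp_end_iso E (Set.projIcc (0 : ℝ) ε hε ε)
      (by rw [Set.projIcc_of_mem hε ⟨hε, le_rfl⟩])
    exact pExt_eq_of_iso i

/-! ### Supports -/

section Support

variable {e : EReal → EReal → ℤ}

/-- All these points lie in the quadrant box with corner `(z, z)`, each contributing at least one to
a sum bounded by the finite alternating sum of that box. -/
lemma finite_support_of_between (he : BoxNonneg e) (z : EReal) :
    {q : EReal × EReal | q.1 < z ∧ z < q.2 ∧ 0 < pointMult e q.1 q.2}.Finite := by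
  by_contra hinf
  obtain ⟨T, hT, hcard⟩ := Set.Infinite.exists_subset_card_eq hinf ((box e ⊥ z z ⊤).toNat + 1)
  have h1 : ∑ q ∈ T, pointMult e q.1 q.2 ≤ box e ⊥ z z ⊤ :=
    sum_pointMult_le_box he T bot_le le_rfl le_top fun q hq =>
      ⟨Or.inr rfl, Or.inl (hT hq).1, Or.inl (hT hq).2.1, Or.inr rfl⟩
  have h2 : (T.card : ℤ) ≤ ∑ q ∈ T, pointMult e q.1 q.2 := by
    have := Finset.card_nsmul_le_sum T (fun q => pointMult e q.1 q.2) 1 fun q hq => (hT hq).2.2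
    simpa using this
  have h3 := Int.self_le_toNat (box e ⊥ z z ⊤)
  rw [hcard] at h2
  push_cast at h2
  linarith

lemma countable_support (he : BoxNonneg e) :
    {q : EReal × EReal | q.1 < q.2 ∧ 0 < pointMult e q.1 q.2}.Countable := by
  refine (Set.countable_iUnion fun r : ℚ =>
    (finite_support_of_between he ((r : ℝ) : EReal)).countable).mono ?_
  rintro q ⟨hq, hm⟩
  obtain ⟨r, h1, h2⟩ := EReal.lt_iff_exists_rat_btwn.1 hq
  exact Set.mem_iUnion.2 ⟨r, h1, h2, hm⟩

end Support

/-! ### Distances -/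

lemma extDist_le_of_near {δ : ℝ≥0} {u w : EReal} (h : Near δ u w) : extDist u w ≤ δ := by
  induction u using EReal.rec with
  | bot => rw [near_bot] at h; subst h; simp [extDist]
  | top => rw [near_top] at h; subst h; simp [extDist]
  | coe x =>
    induction w using EReal.rec with
    | bot => exact absurd h not_near_coe_bot
    | top => exact absurd h not_near_coe_top
    | coe y =>
      rw [near_coe] at h
      unfold extDist
      split_ifs
      · exact bot_le
      · rw [← EReal.coe_sub, EReal.abs_def]
        exact ENNReal.ofReal_le_of_le_toReal h

lemma supDist_le_of_near₂ {δ : ℝ≥0} {q z : EReal × EReal} (h : Near₂ δ q z) : supDist q z ≤ δ :=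
  max_le (extDist_le_of_near h.1) (extDist_le_of_near h.2)

/-- A point above the diagonal whose closed `ε`-neighbourhood meets the diagonal is within `ε` of a
finite point of the diagonal. -/
lemma exists_near₂_diagonal {ε : ℝ} {q : EReal × EReal} (hq : q.1 < q.2)
    (h : ¬ q.1 + ε < q.2 - ε) : ∃ r : ℝ, Near₂ ε q ((r : EReal), (r : EReal)) := by
  obtain ⟨u, w⟩ := q
  simp only at hq h
  induction u using EReal.rec with
  | top => exact absurd hq not_top_lt
  | bot =>
    induction w using EReal.rec with
    | bot => exact absurd hq (lt_irrefl _)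
    | top => simp at h
    | coe y => exact absurd (by rw [EReal.bot_add, ← EReal.coe_sub]; exact EReal.bot_lt_coe _) h
  | coe x =>
    induction w using EReal.rec with
    | bot => exact absurd hq not_lt_bot
    | top => exact absurd (by rw [EReal.top_sub_coe, ← EReal.coe_add]; exact EReal.coe_lt_top _) h
    | coe y =>
      have hxy : x < y := by exact_mod_cast hq
      have h' : y - ε ≤ x + ε := by
        rw [not_lt] at h
        exact_mod_cast h
      refine ⟨(x + y) / 2, near_coe.2 ?_, near_coe.2 ?_⟩ <;> rw [abs_le] <;>
        constructor <;> linarith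

/-! ### Matchings -/

lemma diagram_of_lt {q : EReal × EReal} (h : q.1 < q.2) :
    diagram p F q = ((pointMult (pExt p F) q.1 q.2).toNat : ℕ∞) := by
  rw [diagram, if_pos h, cornerMultiplicity_eq_pointMult h]

lemma diagram_diagonal (r : ℝ) : diagram p F ((r : EReal), (r : EReal)) = ⊤ := by
  rw [diagram, if_neg (lt_irrefl _), if_pos ⟨r, rfl⟩]

lemma eq_diagonal_of_lt_diagram {q : EReal × EReal} {n : ℕ} (hn : (n : ℕ∞) < diagram p F q)
    (h : ¬ q.1 < q.2) : ∃ r : ℝ, q = ((r : EReal), (r : EReal)) := by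
  by_contra hr
  rw [diagram, if_neg h, if_neg hr] at hn
  exact absurd hn not_lt_bot

lemma lt_toNat_of_lt_diagram {q : EReal × EReal} {n : ℕ} (hn : (n : ℕ∞) < diagram p F q)
    (h : q.1 < q.2) : n < (pointMult (pExt p F) q.1 q.2).toNat := by
  rw [diagram_of_lt h] at hn
  exact_mod_cast hn

/-- The elements of the diagram of `F` further than `ε` from the diagonal. -/
def FarElem (p : CatPersistenceFunction C) (F : ℝ ⥤ C) (ε : ℝ) : Type :=
  {x : (diagram p F).Elem // x.1.1.1 + ε < x.1.1.2 - ε}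

lemma lt_of_add_lt_sub {ε : ℝ} (hε : 0 ≤ ε) {u v : EReal} (h : u + ε < v - ε) : u < v := by
  have hε' : (0 : EReal) ≤ ε := by exact_mod_cast hε
  exact ((le_add_of_nonneg_right hε').trans_lt h).trans_le
    (EReal.sub_le_of_le_add (le_add_of_nonneg_right hε'))

/-- The elements far from the diagonal can be matched injectively. -/
lemma Interleaved.exists_injective_far [Limits.HasFiniteColimits C] {ε : ℝ≥0}
    (h : Interleaved ε F G) :
    ∃ f : FarElem p F ε → (diagram p G).Elem, Function.Injective f ∧
      ∀ x, Near₂ ε x.1.1.1 (f x).1.1 ∧ (f x).1.1.1 < (f x).1.1.2 := by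
  classical
  obtain ⟨e, he, he0, he1⟩ := h.exists_boxFlow (p := p)
  have hε : (0 : ℝ) ≤ ε := ε.2
  set mF : EReal × EReal → ℤ := fun q => pointMult (pExt p F) q.1 q.2 with hmF
  set mG : EReal × EReal → ℤ := fun q => pointMult (pExt p G) q.1 q.2 with hmG
  have hS : ∀ x : FarElem p F ε, {q : EReal × EReal | Near₂ ε x.1.1.1 q ∧ 0 < mG q}.Finite := by
    intro x
    obtain ⟨z, h1, h2⟩ := exists_between x.2
    refine (finite_support_of_between (boxNonneg_pExt p G) z).subset ?_
    rintro q ⟨hq, hm⟩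
    exact ⟨hq.1.2.trans_lt h1, h2.trans_le hq.2.1, hm⟩
  -- The admissible partners of `x`: the copies of cornerpoints of `G` within `ε`. There are
  -- finitely many, since all lie in a quadrant away from the diagonal.
  set t : FarElem p F ε → Finset (Σ _ : EReal × EReal, ℕ) := fun x =>
    (hS x).toFinset.sigma fun q => Finset.range (mG q).toNat with ht
  have hall : ∀ s : Finset (FarElem p F ε), s.card ≤ (s.biUnion t).card := by
    intro s
    set A : Finset (EReal × EReal) := s.image fun x => x.1.1.1 with hA
    have hAfar : ∀ q ∈ A, q.1 + (ε : ℝ) < q.2 - (ε : ℝ) := by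
      intro q hq
      obtain ⟨x, -, rfl⟩ := Finset.mem_image.1 hq
      exact x.2
    have hcard : s.card ≤ (A.sigma fun q => Finset.range (mF q).toNat).card := by
      refine Finset.card_le_card_of_injOn (fun x => ⟨x.1.1.1, x.1.1.2⟩) ?_ ?_
      · intro x hx
        exact Finset.mem_sigma.2 ⟨Finset.mem_image.2 ⟨x, hx, rfl⟩,
          Finset.mem_range.2 (lt_toNat_of_lt_diagram x.1.2 (lt_of_add_lt_sub hε x.2))⟩
      · intro x _ y _ hxy
        simp only [Sigma.mk.injEq, heq_eq_eq] at hxy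
        exact Subtype.ext (Subtype.ext (Prod.ext hxy.1 hxy.2))
    -- Mass conservation, started from `A` itself, yields Hall's condition for `s`.
    have hmass : HasMass e A (∑ q ∈ A, mF q) 0 :=
      ⟨A, fun q hq => ⟨q, hq, near_refl le_rfl _, near_refl le_rfl _⟩, by rw [he0]⟩
    obtain ⟨T, hT, hsum⟩ := he.hasMass hε hAfar hmass
    rw [he1] at hsum
    have hTlt : ∀ z ∈ T, z.1 < z.2 := by
      intro z hz
      obtain ⟨q, hq, hqz⟩ := hT z hz
      exact lt_of_near₂ (hAfar q hq) le_rfl hqz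
    have hsumF : ((A.sigma fun q => Finset.range (mF q).toNat).card : ℤ) = ∑ q ∈ A, mF q := by
      rw [Finset.card_sigma]
      push_cast
      refine Finset.sum_congr rfl fun q hq => ?_
      rw [Finset.card_range, Int.toNat_of_nonneg]
      exact pointMult_nonneg (boxNonneg_pExt p F) (lt_of_add_lt_sub hε (hAfar q hq))
    have hsumG : ((T.sigma fun q => Finset.range (mG q).toNat).card : ℤ) = ∑ q ∈ T, mG q := by
      rw [Finset.card_sigma]
      push_cast
      refine Finset.sum_congr rfl fun q hq => ?_
      rw [Finset.card_range, Int.toNat_of_nonneg]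
      exact pointMult_nonneg (boxNonneg_pExt p G) (hTlt q hq)
    have hsub : (T.sigma fun q => Finset.range (mG q).toNat) ⊆ s.biUnion t := by
      intro y hy
      obtain ⟨hy1, hy2⟩ := Finset.mem_sigma.1 hy
      obtain ⟨q, hq, hqy⟩ := hT y.1 hy1
      obtain ⟨x, hx, rfl⟩ := Finset.mem_image.1 hq
      refine Finset.mem_biUnion.2 ⟨x, hx, Finset.mem_sigma.2 ⟨?_, hy2⟩⟩
      rw [Set.Finite.mem_toFinset]
      exact ⟨hqy, Int.pos_iff_toNat_pos.2 (bot_le.trans_lt (Finset.mem_range.1 hy2))⟩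
    refine hcard.trans (le_trans ?_ (Finset.card_le_card hsub))
    exact_mod_cast (hsumF.le.trans hsum).trans hsumG.ge
  obtain ⟨f, hf, hft⟩ := (Finset.all_card_le_biUnion_card_iff_exists_injective t).1 hall
  have hnear : ∀ x, Near₂ ε x.1.1.1 (f x).1 := fun x =>
    ((hS x).mem_toFinset.1 (Finset.mem_sigma.1 (hft x)).1).1
  have hlt : ∀ x, (f x).1.1 < (f x).1.2 := fun x => lt_of_near₂ x.2 le_rfl (hnear x)
  refine ⟨fun x => ⟨((f x).1, (f x).2), ?_⟩, ?_, fun x => ⟨hnear x, hlt x⟩⟩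
  · rw [diagram_of_lt (hlt x)]
    exact_mod_cast Finset.mem_range.1 (Finset.mem_sigma.1 (hft x)).2
  · intro x y hxy
    have hxy := congrArg Subtype.val hxy
    simp only [Prod.mk.injEq] at hxy
    exact hf (Sigma.ext hxy.1 (heq_of_eq hxy.2))

/-- The diagram of `F` can be matched injectively into the diagram of an interleaved `G`. -/
lemma Interleaved.exists_injective [Limits.HasFiniteColimits C] {ε : ℝ≥0}
    (h : Interleaved ε F G) :
    ∃ f : (diagram p F).Elem → (diagram p G).Elem, Function.Injective f ∧
      ∀ x, Near₂ ε x.1.1 (f x).1.1 := by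
  classical
  have hε : (0 : ℝ) ≤ ε := ε.2
  obtain ⟨f, hf, hfn⟩ := h.exists_injective_far (p := p)
  obtain ⟨c, hc⟩ := Set.countable_iff_exists_injOn.1 (countable_support (boxNonneg_pExt p F))
  -- Diagonal target of an element that is not far; an element already on the diagonal must keep its
  -- place.
  have hd : ∀ x : (diagram p F).Elem, ∃ r : ℝ,
      ¬ x.1.1.1 + (ε : ℝ) < x.1.1.2 - (ε : ℝ) → Near₂ ε x.1.1 ((r : EReal), (r : EReal)) ∧
        (¬ x.1.1.1 < x.1.1.2 → x.1.1 = ((r : EReal), (r : EReal))) := by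
    intro x
    by_cases hx : x.1.1.1 < x.1.1.2
    · by_cases hfar : x.1.1.1 + (ε : ℝ) < x.1.1.2 - (ε : ℝ)
      · exact ⟨0, fun h => absurd hfar h⟩
      · obtain ⟨r, hr⟩ := exists_near₂_diagonal hx hfar
        exact ⟨r, fun _ => ⟨hr, fun h => absurd hx h⟩⟩
    · obtain ⟨r, hr⟩ := eq_diagonal_of_lt_diagram x.2 hx
      exact ⟨r, fun _ => ⟨by rw [hr]; exact ⟨near_refl hε _, near_refl hε _⟩, fun _ => hr⟩⟩
  choose d hd using hd
  -- Which copy of the diagonal point to use: diagonal elements take even copies, cornerpoints take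
  -- odd ones, numbered through the countable support, so no two collide.
  set k : (diagram p F).Elem → ℕ := fun x =>
    if x.1.1.1 < x.1.1.2 then 2 * Nat.pair (c x.1.1) x.1.2 + 1 else 2 * x.1.2 with hk
  have hkinj : ∀ x y : (diagram p F).Elem, ¬ x.1.1.1 + (ε : ℝ) < x.1.1.2 - (ε : ℝ) →
      ¬ y.1.1.1 + (ε : ℝ) < y.1.1.2 - (ε : ℝ) → d x = d y → k x = k y → x = y := by
    intro x y hx hy hdxy hkxy
    have hsupp : ∀ x : (diagram p F).Elem, x.1.1.1 < x.1.1.2 →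
        x.1.1 ∈ {q : EReal × EReal | q.1 < q.2 ∧ 0 < pointMult (pExt p F) q.1 q.2} := fun x hx =>
      ⟨hx, Int.pos_iff_toNat_pos.2 (bot_le.trans_lt (lt_toNat_of_lt_diagram x.2 hx))⟩
    simp only [hk] at hkxy
    split_ifs at hkxy with h1 h2 h2
    · have h3 : Nat.pair (c x.1.1) x.1.2 = Nat.pair (c y.1.1) y.1.2 := by omega
      obtain ⟨h4, h5⟩ := Nat.pair_eq_pair.1 h3
      exact Subtype.ext (Prod.ext (hc (hsupp x h1) (hsupp y h2) h4) h5)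
    · omega
    · omega
    · have h3 : x.1.2 = y.1.2 := by omega
      refine Subtype.ext (Prod.ext ?_ h3)
      rw [(hd x hx).2 h1, (hd y hy).2 h2, hdxy]
  have hΦ : ∀ x : (diagram p F).Elem, ∃ y : (diagram p G).Elem,
      (∀ hx : x.1.1.1 + (ε : ℝ) < x.1.1.2 - (ε : ℝ), y = f ⟨x, hx⟩) ∧
      (¬ x.1.1.1 + (ε : ℝ) < x.1.1.2 - (ε : ℝ) →
        y.1 = (((d x : EReal), (d x : EReal)), k x)) := by
    intro x
    by_cases hx : x.1.1.1 + (ε : ℝ) < x.1.1.2 - (ε : ℝ)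
    · exact ⟨f ⟨x, hx⟩, fun _ => rfl, fun h => absurd hx h⟩
    · exact ⟨⟨(((d x : EReal), (d x : EReal)), k x), by
        rw [diagram_diagonal]; exact ENat.natCast_lt_top _⟩, fun h => absurd h hx, fun _ => rfl⟩
  choose Φ hΦ₁ hΦ₂ using hΦ
  -- Far elements land strictly above the diagonal and the others on it, so injectivity can be
  -- checked on each class.
  have hlt : ∀ x : (diagram p F).Elem, x.1.1.1 + (ε : ℝ) < x.1.1.2 - (ε : ℝ) ↔ (Φ x).1.1.1 < (Φ x).1.1.2 := by
    intro x
    by_cases hx : x.1.1.1 + (ε : ℝ) < x.1.1.2 - (ε : ℝ)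
    · rw [hΦ₁ x hx]
      exact iff_of_true hx (hfn ⟨x, hx⟩).2
    · rw [hΦ₂ x hx]
      exact iff_of_false hx (lt_irrefl _)
  refine ⟨Φ, fun x y hxy => ?_, fun x => ?_⟩
  · by_cases hx : x.1.1.1 + (ε : ℝ) < x.1.1.2 - (ε : ℝ)
    · have hy := (hlt y).2 (hxy ▸ (hlt x).1 hx)
      rw [hΦ₁ x hx, hΦ₁ y hy] at hxy
      exact congrArg Subtype.val (hf hxy)
    · have hy := fun hy => hx ((hlt x).2 (hxy ▸ (hlt y).1 hy))
      have hxy := congrArg Subtype.val hxy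
      rw [hΦ₂ x hx, hΦ₂ y hy] at hxy
      simp only [Prod.mk.injEq, EReal.coe_eq_coe_iff, and_self] at hxy
      exact hkinj x y hx hy hxy.1 hxy.2
  · by_cases hx : x.1.1.1 + (ε : ℝ) < x.1.1.2 - (ε : ℝ)
    · rw [hΦ₁ x hx]
      exact (hfn ⟨x, hx⟩).1
    · rw [hΦ₂ x hx]
      exact (hd x hx).1

/-- Interleaved diagrams have persistence diagrams at bottleneck distance at most `ε`. -/
theorem Interleaved.bottleneckDist_le [Limits.HasFiniteColimits C] {ε : ℝ≥0}
    (h : Interleaved ε F G) : bottleneckDist (diagram p F) (diagram p G) ≤ ε := by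
  obtain ⟨f, hf, hfn⟩ := h.exists_injective (p := p)
  obtain ⟨g, hg, hgn⟩ := h.symm.exists_injective (p := p)
  -- The bijection agrees at each element with `f` or with the inverse of `g`, so it inherits the
  -- bound `ε` from both.
  obtain ⟨β, hβ, hβn⟩ := Function.Embedding.schroeder_bernstein_of_rel hf hg
    (fun x y => Near₂ ε x.1.1 y.1.1) hfn fun y => (hgn y).symm
  exact iInf_le_of_le (Equiv.ofBijective β hβ) (iSup_le fun x => supDist_le_of_near₂ (hβn x))

end Persistence

theorem mainTheorem4 {R : Type u} [Category.{v} R] [Limits.HasFiniteColimits R]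
    (p : CatPersistenceFunction R) (F₁ F₂ : ℝ ⥤ R)
    (h₁ : Persistence.IsTame p F₁) (h₂ : Persistence.IsTame p F₂) :
    Persistence.interleavingDist F₁ F₂ ≥
      Persistence.bottleneckDist (Persistence.diagram p F₁) (Persistence.diagram p F₂) :=
  le_iInf₂ fun _ h => h.bottleneckDist_le
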